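/- **Setting.** Let $T_j,U_j$ be the Chebyshev polynomials of the first and second kind, $s\ge1$ the number of stages and $\varepsilon\ge 0$ the damping parameter. Put $\omega_0=1+\varepsilon/s^2$ and - (first-order coefficients, $p=1$, $s\ge 1$) $\omega_1=T_s(\omega_0)/T_s'(\omega_0)$, $b_j=1/T_j(\omega_0)$, $\beta=(2-\tfrac43\varepsilon)s^2$; - (second-order coefficients, $p=2$, $s\ge2$) $\omega_1=T_s'(\omega_0)/T_s''(\omega_0)$, $b_j=T_j''(\omega_0)/T_j'(\omega_0)^2$ for $j\ge2$, $b_0=b_1=b_2$, $\beta=\tfrac23(1-\tfrac2{15}\varepsilon)(s^2-1)$. In both cases $\mu_1=b_1\omega_1$ and, for $j\ge 2$, $\mu_j=2\omega_1b_j/b_{j-1}$, $\nu_j=2\omega_0b_j/b_{j-1}$, $\kappa_j=-b_j/b_{j-2}$, $\gamma_j=-\mu_ja_{j-1}$ with $a_j=1-b_jT_j(\omega_0)$. For $p=2$ let $C_s=\sum_{j=1}^s\frac{b_s}{b_j}U_{s-j}(\omega_0)\mu_j$. Given $f:\mathbb R^n\to\mathbb R^n$, $\Delta t>0$ and $y,\hat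 y\in\mathbb R^n$, the exact RKC step is $y^+=y+d_s$ with $d_0=0$, $d_1=\mu_1\Delta t f(y)$, $d_j=\nu_jd_{j-1}+\kappa_jd_{j-2}+\mu_j\Delta t f(y+d_{j-1})+\gamma_j\Delta t f(y)$. The mixed-precision step is $\hat y^+=\hat y+\hat d_s$ with $\hat d_0=0$, $\hat d_1=\mu_1\Delta t f(\hat y)$, $\hat d_j=\nu_j\hat d_{j-1}+\kappa_j\hat d_{j-2}+\mu_j\Delta t(f(\hat y)+\hat\Delta f_{j-1})+\gamma_j\Delta t f(\hat y)$, where the $\hat\Delta f_j\in\mathbb R^n$ approximate $\Delta f_j=f(\hat y+\hat d_j)-f(\hat y)$. All norms are Euclidean (operator) norms. **Assumptions.** $f$ is twice differentiable, $\|f''\|\le C_{f''}$ everywhere, and $f'(x)$ is symmetric and nonpositive definite for every $x$. The number of stages satisfies $\Delta t\,\rho\le\beta$ for the spectral radii $\rho$ of $f'(y)$ and of $f'(\hat y)$. There are $C_d\ge2$, $C_\Delta>0$, $\hat C\ge0$, $\epsilon>0$ with $\|d_j\|\le C_d\|y\|$ and $\|\hat d_j\|\le C_d\|\hat y\|$ for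 $1\le j\le s$, and $\|\hat\Delta f_j-\Delta f_j\|\le C_\Delta\|\hat y\|$ and $\|\hat\Delta f_j-\Delta f_j\|\le\hat C\epsilon\Delta t$ for $1\le j<s$. **Theorem.** For every $\varepsilon\ge0$ there are $K$ and $\eta>0$, depending only on $\varepsilon$ (not on $s,n,f,\Delta t$ or any other datum), such that $C_s\le K$ for all $s\ge2$ and the following holds under the above assumptions. Write $E=\|\hat y-y\|$ and $r=\min(\hat C\epsilon\Delta t,\,C_\Delta\|\hat y\|)$. 1. *(Estimate for every step size.)* The bounds in 2 hold with $\hat m=\|\hat y\|$ and $m=\|y\|$. 2. *(Sharp estimate.)* Suppose that the exact scheme satisfies either $\|d_j\|\le C_d\Delta t\|f(y)\|$ for $1\le j<s$, or $C_{f''}C_d\|y\|\Delta t\le\eta$; and that the mixed-precision scheme satisfies either $\|\hat d_j\|\le C_d\Delta t\|f(\hat y)\|$ for $1\le j<s$, or both $C_{f''}C_d\|\hat y\|\Delta t\le\eta$ and $r\le\eta\|f(\hat y)\|$. Then, with $\hat m=\min(\Delta t\|f(\hat y)\|,\|\hat y\|)$ and $m=\min(\Delta t\|f(y)\|,\|y\|)$: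 - for first-order coefficients, $$\|\hat y^+-y^+\|\le E+C_{f''}E^2\Delta t+r\Delta t+C_{f''}C_d^2(\hat m^2+m^2)\Delta t;$$ - for second-order coefficients, $$\|\hat y^+-y^+\|\le E+C_{f''}(1+2C_s)E^2\Delta t+C_s\,r\,\Delta t+C_sC_{f''}C_d^2(\hat m^2+m^2)\Delta t.$$ Moreover, without damping ($\varepsilon=0$), $C_s\le 4s(s+1)/(s^2-1)\le 8$ for all $s\ge2$. -/

import Mathlib

noncomputable section

/-- The state space `ℝⁿ` with the Euclidean norm. -/
abbrev RKCState (n : ℕ) : Type := EuclideanSpace ℝ (Fin n)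

/-- Value at `x` of the Chebyshev polynomial of the first kind `T_j`. -/
def chebT (j : ℕ) (x : ℝ) : ℝ := (Polynomial.Chebyshev.T ℝ (j : ℤ)).eval x

/-- Value at `x` of the derivative `T_j'`. -/
def chebT' (j : ℕ) (x : ℝ) : ℝ :=
  (Polynomial.derivative (Polynomial.Chebyshev.T ℝ (j : ℤ))).eval x

/-- Value at `x` of the second derivative `T_j''`. -/
def chebT'' (j : ℕ) (x : ℝ) : ℝ :=
  (Polynomial.derivative (Polynomial.derivative (Polynomial.Chebyshev.T ℝ (j : ℤ)))).eval x

/-- Value at `x` of the Chebyshev polynomial of the second kind `U_j`. -/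
def chebU (j : ℕ) (x : ℝ) : ℝ := (Polynomial.Chebyshev.U ℝ (j : ℤ)).eval x

/-- The core coefficients `ω₀`, `ω₁` and `b_j` of a Runge–Kutta–Chebyshev method. -/
structure RKCCoeffs where
  ω₀ : ℝ
  ω₁ : ℝ
  b : ℕ → ℝ

namespace RKCCoeffs

/-- `a_j = 1 - b_j T_j(ω₀)`. -/
def a (C : RKCCoeffs) (j : ℕ) : ℝ := 1 - C.b j * chebT j C.ω₀

/-- `μ₁ = b₁ ω₁` and `μ_j = 2 ω₁ b_j / b_{j-1}` for `j ≥ 2`. -/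
def μ (C : RKCCoeffs) (j : ℕ) : ℝ :=
  if j = 1 then C.b 1 * C.ω₁ else 2 * C.ω₁ * C.b j / C.b (j - 1)

/-- `ν_j = 2 ω₀ b_j / b_{j-1}`, used only for `j ≥ 2`. -/
def ν (C : RKCCoeffs) (j : ℕ) : ℝ := 2 * C.ω₀ * C.b j / C.b (j - 1)

/-- `κ_j = - b_j / b_{j-2}`, used only for `j ≥ 2`. -/
def κ (C : RKCCoeffs) (j : ℕ) : ℝ := -(C.b j / C.b (j - 2))

/-- `γ_j = - μ_j a_{j-1}`, used only for `j ≥ 2`. -/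
def γ (C : RKCCoeffs) (j : ℕ) : ℝ := -(C.μ j * C.a (j - 1))

end RKCCoeffs

/-- First-order (RKC1) coefficients with `s` stages and damping parameter `ε`. -/
def rkc1 (s : ℕ) (ε : ℝ) : RKCCoeffs where
  ω₀ := 1 + ε / (s : ℝ) ^ 2
  ω₁ := chebT s (1 + ε / (s : ℝ) ^ 2) / chebT' s (1 + ε / (s : ℝ) ^ 2)
  b := fun j => 1 / chebT j (1 + ε / (s : ℝ) ^ 2)

/-- Second-order (RKC2) coefficients with `s` stages and damping parameter `ε`;
here `b₀ = b₁ = b₂`. -/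
def rkc2 (s : ℕ) (ε : ℝ) : RKCCoeffs where
  ω₀ := 1 + ε / (s : ℝ) ^ 2
  ω₁ := chebT' s (1 + ε / (s : ℝ) ^ 2) / chebT'' s (1 + ε / (s : ℝ) ^ 2)
  b := fun j =>
    chebT'' (max j 2) (1 + ε / (s : ℝ) ^ 2) / chebT' (max j 2) (1 + ε / (s : ℝ) ^ 2) ^ 2

/-- The bound `β¹(s, ε)` on `Δt ρ` under which RKC1 is run. -/
def rkcβ1 (s : ℕ) (ε : ℝ) : ℝ := (2 - 4 / 3 * ε) * (s : ℝ) ^ 2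

/-- The bound `β²(s, ε)` on `Δt ρ` under which RKC2 is run. -/
def rkcβ2 (s : ℕ) (ε : ℝ) : ℝ := 2 / 3 * (1 - 2 / 15 * ε) * ((s : ℝ) ^ 2 - 1)

/-- The constant `C_s = ∑_{j=1}^s (b_s / b_j) U_{s-j}(ω₀) μ_j`. -/
def rkcStageConst (C : RKCCoeffs) (s : ℕ) : ℝ :=
  ∑ j ∈ Finset.Icc 1 s, C.b s / C.b j * chebU (s - j) C.ω₀ * C.μ j

/-- The stage increments `d_j` of the exact RKC scheme started at `y`. -/
def rkcStage {n : ℕ} (C : RKCCoeffs) (Δt : ℝ) (f : RKCState n → RKCState n) (y : RKCState n) :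
    ℕ → RKCState n
  | 0 => 0
  | 1 => (C.μ 1 * Δt) • f y
  | j + 2 =>
      C.ν (j + 2) • rkcStage C Δt f y (j + 1) + C.κ (j + 2) • rkcStage C Δt f y j
        + (C.μ (j + 2) * Δt) • f (y + rkcStage C Δt f y (j + 1))
        + (C.γ (j + 2) * Δt) • f y

/-- One step `y ↦ y + d_s` of the exact `s`-stage RKC scheme. -/
def rkcStep {n : ℕ} (C : RKCCoeffs) (s : ℕ) (Δt : ℝ) (f : RKCState n → RKCState n)
    (y : RKCState n) : RKCState n :=
  y + rkcStage C Δt f y s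

/-- The stage increments of the mixed-precision RKC scheme started at `y`, where `D j` is the
low-precision quantity which stands for the difference `f (y + d_j) - f y` at stage `j`. -/
def mpStage {n : ℕ} (C : RKCCoeffs) (Δt : ℝ) (f : RKCState n → RKCState n)
    (D : ℕ → RKCState n) (y : RKCState n) : ℕ → RKCState n
  | 0 => 0
  | 1 => (C.μ 1 * Δt) • f y
  | j + 2 =>
      C.ν (j + 2) • mpStage C Δt f D y (j + 1) + C.κ (j + 2) • mpStage C Δt f D y j
        + (C.μ (j + 2) * Δt) • (f y + D (j + 1))
        + (C.γ (j + 2) * Δt) • f y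

/-- One step `y ↦ y + d_s` of the `s`-stage mixed-precision RKC scheme. -/
def mpStep {n : ℕ} (C : RKCCoeffs) (s : ℕ) (Δt : ℝ) (f : RKCState n → RKCState n)
    (D : ℕ → RKCState n) (y : RKCState n) : RKCState n :=
  y + mpStage C Δt f D y s

/-- The spectral radius of the Jacobian `f'(y)`. -/
def jacSpectralRadius {n : ℕ} (f : RKCState n → RKCState n) (y : RKCState n) : ℝ :=
  (spectralRadius ℝ (fderiv ℝ f y)).toReal

/-- The standing assumptions on one step of the exact scheme from `y` and of the 1-order-preserving
mixed-precision scheme from `yh`, both with coefficients `C`, number of stages `s` and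
step size `Δt`. `D j` is the low-precision approximation of `Δf_j = f (yh + dh_j) - f yh`, and
`Ch`, `ϵ` are the constants of the requirement `D j = Δf_j + O(ϵ Δt)`. -/
structure OneStepAssumptions {n : ℕ} (C : RKCCoeffs) (β : ℝ) (s : ℕ) (Δt : ℝ)
    (f : RKCState n → RKCState n) (D : ℕ → RKCState n) (y yh : RKCState n)
    (Cf Cd CΔ Ch ϵ : ℝ) : Prop where
  step_pos : 0 < Δt
  two_le_Cd : 2 ≤ Cd
  CΔ_pos : 0 < CΔ
  Ch_nonneg : 0 ≤ Ch
  ϵ_pos : 0 < ϵ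
  /-- `f` is twice differentiable. -/
  differentiable : Differentiable ℝ f
  differentiable_fderiv : Differentiable ℝ (fderiv ℝ f)
  /-- `‖f''‖ ≤ C_{f''}`. -/
  norm_second_deriv_le : ∀ x, ‖fderiv ℝ (fderiv ℝ f) x‖ ≤ Cf
  /-- `f'` is symmetric and nonpositive definite. -/
  jac_nonpos : ∀ x, (-(fderiv ℝ f x)).IsPositive
  /-- The number of stages is chosen such that `Δt ρ ≤ β` for both schemes. -/
  stages_exact : Δt * jacSpectralRadius f y ≤ β
  stages_mixed : Δt * jacSpectralRadius f yh ≤ β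
  /-- Internal stability of the exact scheme and of the mixed-precision scheme. -/
  stable_exact : ∀ j, 1 ≤ j → j ≤ s → ‖rkcStage C Δt f y j‖ ≤ Cd * ‖y‖
  stable_mixed : ∀ j, 1 ≤ j → j ≤ s → ‖mpStage C Δt f D yh j‖ ≤ Cd * ‖yh‖
  /-- Internal stability of the low-precision evaluations. -/
  stable_diff : ∀ j, 1 ≤ j → j < s →
    ‖D j - (f (yh + mpStage C Δt f D yh j) - f yh)‖ ≤ CΔ * ‖yh‖
  /-- First-order accuracy of the low-precision evaluations. -/
  accurate_diff : ∀ j, 1 ≤ j → j < s →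
    ‖D j - (f (yh + mpStage C Δt f D yh j) - f yh)‖ ≤ Ch * ϵ * Δt

/-- The stage increments of the exact scheme are of first order, with constant `Cd`. This holds
by assumption, or because `Δt` is small relative to a threshold `η`. -/
def ExactFirstOrder {n : ℕ} (η : ℝ) (C : RKCCoeffs) (s : ℕ) (Δt : ℝ)
    (f : RKCState n → RKCState n) (y : RKCState n) (Cf Cd : ℝ) : Prop :=
  (∀ j, 1 ≤ j → j < s → ‖rkcStage C Δt f y j‖ ≤ Cd * (Δt * ‖f y‖)) ∨
    Cf * Cd * ‖y‖ * Δt ≤ η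

/-- The stage increments of the mixed-precision scheme are of first order, with constant `Cd`.
This holds by assumption, or because `Δt` is small relative to a threshold `η`. -/
def MixedFirstOrder {n : ℕ} (η : ℝ) (C : RKCCoeffs) (s : ℕ) (Δt : ℝ)
    (f : RKCState n → RKCState n) (D : ℕ → RKCState n) (yh : RKCState n)
    (Cf Cd CΔ Ch ϵ : ℝ) : Prop :=
  (∀ j, 1 ≤ j → j < s → ‖mpStage C Δt f D yh j‖ ≤ Cd * (Δt * ‖f yh‖)) ∨
    (Cf * Cd * ‖yh‖ * Δt ≤ η ∧ min (Ch * ϵ * Δt) (CΔ * ‖yh‖) ≤ η * ‖f yh‖)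

end

/-! Linearise at y with J = f'(y) and divide stage j by b_j: the scheme becomes the Chebyshev
recurrence for W = ω₀ + ω₁ Δt J. Hence the difference of the two runs at stage j is a_j + b_j T_j(W)
applied to ŷ - y, plus a sum of operators U_{j-i}(W) acting on perturbations (`norm_add_stage_le`).
Since Δt ρ ≤ β and ω₁ β ≤ 2 ω₀, the symmetric W has its spectrum in [-ω₀, ω₀], where |T_k| and |U_k|
are largest at ω₀. As a_j ≥ 0, the operator a_j + b_j T_j(W) is a contraction, so E enters with
factor 1. The perturbation common to all stages is weighted by b_j ω₁ T_j'(ω₀) ≤ 1, those of the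
individual stages by C_s. They are Taylor remainders, quadratic with constant C_{f''}, and the
low-precision errors, bounded by r.

The remainders involve the stage increments. These are bounded by internal stability, or for small
steps by 2 Δt ‖f(y)‖, which follows by induction from the same stage bound with v = 0.

What the coefficients must satisfy is collected in `RKCCoeffs.Admissible` and rests on Chebyshev
estimates at ω₀ ≥ 1. The Taylor coefficients at 1 give lower bounds for T'/T and T''/T', hence ω₁ β
≤ 2 ω₀ and, for p = 2, the uniform bound on C_s; a Wronskian argument gives b_j ω₁ T_j'(ω₀) ≤ 1; the
Chebyshev differential equation and the Pell identity give a_j ≥ 0 for p = 2. -/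

/-! ### Taylor coefficients of Chebyshev polynomials at 1. -/

open Polynomial in
/-- A real polynomial whose derivatives at `1` are all nonnegative is nonnegative on `[1, ∞)`. -/
theorem eval_nonneg_of_iterate_derivative_eval_one_nonneg {P : ℝ[X]}
    (h : ∀ k, 0 ≤ (derivative^[k] P).eval 1) {x : ℝ} (hx : 1 ≤ x) : 0 ≤ P.eval x := by
  rw [← taylor_eval_sub 1, eval_eq_sum_range]
  refine Finset.sum_nonneg fun k _ => mul_nonneg ?_ (pow_nonneg (by linarith) k)
  have := h k
  rw [← factorial_smul_hasseDeriv, LinearMap.smul_apply, eval_smul, nsmul_eq_mul] at this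
  rw [taylor_coeff]
  exact nonneg_of_mul_nonneg_right this (by positivity)

open Polynomial in
/-- A termwise comparison of Taylor coefficients at `1` gives a lower bound for `P' / P`. -/
theorem mul_eval_le_derivative_eval_mul {P : ℝ[X]} {a c : ℝ}
    (h : ∀ k : ℕ, a * (derivative^[k] P).eval 1 ≤
      (derivative^[k + 1] P).eval 1 + c * k * (derivative^[k] P).eval 1)
    {x : ℝ} (hx : 1 ≤ x) :
    a * P.eval x ≤ (derivative P).eval x * (1 + c * (x - 1)) := by
  have key := eval_nonneg_of_iterate_derivative_eval_one_nonneg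
    (P := derivative P + C c * (derivative P * X - derivative P) - C a * P) (fun k => ?_) hx
  · simp only [eval_sub, eval_add, eval_mul, eval_C, eval_X] at key
    linarith
  · have := h k
    simp only [iterate_derivative_sub, iterate_map_add, iterate_derivative_C_mul,
      iterate_derivative_derivative_mul_X, eval_sub, eval_add, eval_mul, eval_C, eval_X,
      ← Function.iterate_succ_apply, eval_natCast, nsmul_eq_mul, Nat.succ_eq_add_one]
    linarith

open Polynomial in
theorem chebyshevT_iterate_derivative_eval_one_nonneg (n k : ℕ) :
    0 ≤ (derivative^[k] (Chebyshev.T ℝ n)).eval 1 := by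
  -- The recurrence factor n² - k² is negative for k > n, so the induction must also carry the
  -- vanishing of the derivatives of order above n.
  suffices 0 ≤ (derivative^[k] (Chebyshev.T ℝ n)).eval 1 ∧
      (n < k → (derivative^[k] (Chebyshev.T ℝ n)).eval 1 = 0) from this.1
  induction k with
  | zero => simp
  | succ k ih =>
    have h := Chebyshev.iterate_derivative_T_eval_one_recurrence (R := ℝ) n k
    have hk : (0 : ℝ) < 2 * k + 1 := by positivity
    push_cast at h
    rcases lt_trichotomy k n with hkn | rfl | hkn
    · refine ⟨nonneg_of_mul_nonneg_right (h ▸ mul_nonneg ?_ ih.1) hk, fun _ => by omega⟩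
      have : (k : ℝ) ≤ n := by exact_mod_cast hkn.le
      nlinarith [(Nat.cast_nonneg k : (0 : ℝ) ≤ k)]
    · rw [sub_self, zero_mul, mul_eq_zero] at h
      have := h.resolve_left hk.ne'
      exact ⟨this.ge, fun _ => this⟩
    · rw [ih.2 hkn, mul_zero, mul_eq_zero] at h
      have := h.resolve_left hk.ne'
      exact ⟨this.ge, fun _ => this⟩

theorem one_le_chebT (n : ℕ) {x : ℝ} (hx : 1 ≤ x) : 1 ≤ chebT n x :=
  Polynomial.Chebyshev.one_le_eval_T_real n hx

theorem chebT_pos (n : ℕ) {x : ℝ} (hx : 1 ≤ x) : 0 < chebT n x :=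
  one_pos.trans_le (one_le_chebT n hx)

theorem mul_self_sub_one_nonneg (k : ℕ) : (0 : ℝ) ≤ k * (k - 1) := by
  rcases k with _ | k
  · simp
  · push_cast; ring_nf; positivity

/-- The lower bound `n² / (1 + (2n² + 1) (x - 1) / 3)` for the logarithmic derivative of `T_n`. -/
theorem sq_mul_chebT_le {n : ℕ} (hn : 1 ≤ n) {x : ℝ} (hx : 1 ≤ x) :
    (n : ℝ) ^ 2 * chebT n x ≤ chebT' n x * (1 + (2 * (n : ℝ) ^ 2 + 1) / 3 * (x - 1)) := by
  refine mul_eval_le_derivative_eval_mul (fun k => ?_) hx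
  have h := Polynomial.Chebyshev.iterate_derivative_T_eval_one_recurrence (R := ℝ) n k
  have h0 := chebyshevT_iterate_derivative_eval_one_nonneg n k
  push_cast at h
  generalize Polynomial.eval 1 (Polynomial.derivative^[k] (Polynomial.Chebyshev.T ℝ n)) = t at *
  generalize Polynomial.eval 1 (Polynomial.derivative^[k + 1] (Polynomial.Chebyshev.T ℝ n)) = u at *
  have hk : (0 : ℝ) < 2 * k + 1 := by positivity
  have hn' : (1 : ℝ) ≤ n := by exact_mod_cast hn
  -- The constants n² and (2n² + 1)/3 are those making the comparison an equality at k = 0 and k =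
  -- 1; the gap at general k is then a multiple of this product.
  have key : 0 ≤ (k * (k - 1) : ℝ) * (4 * n ^ 2 - 1) * t :=
    mul_nonneg (mul_nonneg (mul_self_sub_one_nonneg k) (by nlinarith)) h0
  refine le_of_mul_le_mul_left ?_ hk
  linarith

/-- The lower bound `((n² - 1) / 3) / (1 + (2n² + 7) (x - 1) / 15)` for the logarithmic derivative
of `T_n'`. -/
theorem sq_sub_one_mul_chebT'_le {n : ℕ} (hn : 1 ≤ n) {x : ℝ} (hx : 1 ≤ x) :
    ((n : ℝ) ^ 2 - 1) / 3 * chebT' n x ≤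
      chebT'' n x * (1 + (2 * (n : ℝ) ^ 2 + 7) / 15 * (x - 1)) := by
  refine mul_eval_le_derivative_eval_mul (fun k => ?_) hx
  have h := Polynomial.Chebyshev.iterate_derivative_T_eval_one_recurrence (R := ℝ) n (k + 1)
  have h0 := chebyshevT_iterate_derivative_eval_one_nonneg n (k + 1)
  simp only [← Function.iterate_succ_apply, Nat.succ_eq_add_one]
  push_cast at h
  generalize Polynomial.eval 1 (Polynomial.derivative^[k + 1] (Polynomial.Chebyshev.T ℝ n)) = t at *
  generalize Polynomial.eval 1 (Polynomial.derivative^[k + 1 + 1] (Polynomial.Chebyshev.T ℝ n)) = u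
    at *
  have hk : (0 : ℝ) < 2 * k + 3 := by positivity
  have hn' : (1 : ℝ) ≤ n := by exact_mod_cast hn
  have key : 0 ≤ (k * (k - 1) : ℝ) * (4 * n ^ 2 - 1) * t :=
    mul_nonneg (mul_nonneg (mul_self_sub_one_nonneg k) (by nlinarith)) h0
  refine le_of_mul_le_mul_left ?_ hk
  linarith

/-! ### Extremal values and recurrences. -/

theorem chebT_mono (n : ℕ) {x y : ℝ} (hx : 1 ≤ x) (hxy : x ≤ y) : chebT n x ≤ chebT n y := by
  have hy := hx.trans hxy
  rw [chebT, chebT, ← Real.cosh_arcosh hx, ← Real.cosh_arcosh hy, Polynomial.Chebyshev.T_real_cosh,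
    Polynomial.Chebyshev.T_real_cosh, Real.cosh_le_cosh, abs_mul, abs_mul]
  have h1 := Real.arcosh_nonneg hx
  have h2 : Real.arcosh x ≤ Real.arcosh y := (Real.arcosh_le_arcosh (by linarith) (by linarith)).2 hxy
  rw [abs_of_nonneg h1, abs_of_nonneg (h1.trans h2)]
  gcongr

/-- Inside [-1, 1] the values are at most 1 in modulus; outside, parity reduces to monotonicity on
[1, ∞). -/
theorem abs_chebT_le (n : ℕ) {w x : ℝ} (hx : 1 ≤ x) (hw : |w| ≤ x) : |chebT n w| ≤ chebT n x := by
  rcases le_total |w| 1 with h | h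
  · exact (Polynomial.Chebyshev.abs_eval_T_real_le_one n h).trans (one_le_chebT n hx)
  · refine le_trans (le_of_eq ?_) (chebT_mono n h hw)
    rcases abs_choice w with h' | h'
    · rw [h', abs_of_pos (chebT_pos n (h'.symm ▸ h))]
    · rw [h'] at h ⊢
      rw [← abs_of_pos (chebT_pos n h), chebT, chebT, Polynomial.Chebyshev.T_eval_neg, abs_mul]
      rcases Int.even_or_odd (n : ℤ) with he | ho
      · simp [Int.negOnePow_even _ he]
      · simp [Int.negOnePow_odd _ ho]

theorem chebT_zero (x : ℝ) : chebT 0 x = 1 := by simp [chebT]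
theorem chebT_one (x : ℝ) : chebT 1 x = x := by simp [chebT]
theorem chebT_add_two (n : ℕ) (x : ℝ) :
    chebT (n + 2) x = 2 * x * chebT (n + 1) x - chebT n x := by
  simp [chebT, Polynomial.Chebyshev.T_add_two]

theorem chebU_zero (x : ℝ) : chebU 0 x = 1 := by simp [chebU]
theorem chebU_one (x : ℝ) : chebU 1 x = 2 * x := by simp [chebU]
theorem chebU_add_two (n : ℕ) (x : ℝ) :
    chebU (n + 2) x = 2 * x * chebU (n + 1) x - chebU n x := by
  simp [chebU, Polynomial.Chebyshev.U_add_two]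

theorem chebU_add_two_eq_chebT (n : ℕ) (x : ℝ) :
    chebU (n + 2) x = 2 * chebT (n + 2) x + chebU n x := by
  have := congr_arg (Polynomial.eval x) (Polynomial.Chebyshev.U_eq_two_mul_T_add_U ℝ n)
  simpa only [Polynomial.eval_add, Polynomial.eval_mul, Polynomial.eval_ofNat, chebU, chebT, Nat.cast_add, Nat.cast_ofNat] using this

/-- U_n is a nonnegative combination of T_k's, so it inherits their bound. -/
theorem abs_chebU_le (n : ℕ) {w x : ℝ} (hx : 1 ≤ x) (hw : |w| ≤ x) : |chebU n w| ≤ chebU n x := by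
  induction n using Nat.twoStepInduction with
  | zero => simp [chebU_zero]
  | one => simpa [chebU_one, abs_mul] using hw
  | more n ih _ =>
    rw [chebU_add_two_eq_chebT, chebU_add_two_eq_chebT]
    refine (abs_add_le _ _).trans (add_le_add ?_ ih)
    rw [abs_mul, abs_two]
    exact mul_le_mul_of_nonneg_left (abs_chebT_le _ hx hw) two_pos.le

theorem natCast_add_one_le_chebU (n : ℕ) {x : ℝ} (hx : 1 ≤ x) : (n : ℝ) + 1 ≤ chebU n x := by
  refine le_trans ?_ ((le_abs_self _).trans (abs_chebU_le n hx (w := 1) (by simpa)))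
  simp [chebU]

theorem chebU_pos (n : ℕ) {x : ℝ} (hx : 1 ≤ x) : 0 < chebU n x :=
  (by positivity : (0 : ℝ) < n + 1).trans_le (natCast_add_one_le_chebU n hx)

theorem chebT'_zero (x : ℝ) : chebT' 0 x = 0 := by simp [chebT']
theorem chebT'_one (x : ℝ) : chebT' 1 x = 1 := by simp [chebT']
theorem chebT'_two (x : ℝ) : chebT' 2 x = 4 * x := by
  simp [chebT', Polynomial.Chebyshev.T_two]; ring
theorem chebT''_two (x : ℝ) : chebT'' 2 x = 4 := by
  simp [chebT'', Polynomial.Chebyshev.T_two]; norm_num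

theorem chebT'_add_two (n : ℕ) (x : ℝ) :
    chebT' (n + 2) x = 2 * x * chebT' (n + 1) x - chebT' n x + 2 * chebT (n + 1) x := by
  simp [chebT', chebT, Polynomial.Chebyshev.T_add_two]; ring

theorem chebT'_succ (n : ℕ) (x : ℝ) : chebT' (n + 1) x = (n + 1) * chebU n x := by
  simp [chebT', chebU, Polynomial.Chebyshev.T_derivative_eq_U]

theorem sq_le_chebT' (n : ℕ) {x : ℝ} (hx : 1 ≤ x) : (n : ℝ) ^ 2 ≤ chebT' n x := by
  rcases n with _ | n
  · simp [chebT'_zero]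
  · rw [chebT'_succ, sq]
    push_cast
    exact mul_le_mul_of_nonneg_left (natCast_add_one_le_chebU n hx) (by positivity)

theorem chebT'_pos {n : ℕ} (hn : 1 ≤ n) {x : ℝ} (hx : 1 ≤ x) : 0 < chebT' n x :=
  lt_of_lt_of_le (by positivity) (sq_le_chebT' n hx)

theorem chebT''_pos {n : ℕ} (hn : 2 ≤ n) {x : ℝ} (hx : 1 ≤ x) : 0 < chebT'' n x := by
  have h := sq_sub_one_mul_chebT'_le (by omega : 1 ≤ n) hx
  have h1 := chebT'_pos (by omega : 1 ≤ n) hx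
  have hn' : (2 : ℝ) ≤ n := by exact_mod_cast hn
  have h2 : 0 < ((n : ℝ) ^ 2 - 1) / 3 * chebT' n x := mul_pos (by nlinarith) h1
  exact pos_of_mul_pos_left (h2.trans_le h)
    (add_nonneg zero_le_one (mul_nonneg (by positivity) (by linarith)))

/-! ### Differential equation, Pell identity and monotone ratios. -/

theorem chebyshev_ode (n : ℕ) (x : ℝ) :
    (1 - x ^ 2) * chebT'' n x = x * chebT' n x - (n : ℝ) ^ 2 * chebT n x := by
  have := Polynomial.Chebyshev.one_sub_X_sq_mul_iterate_derivative_T_eval (R := ℝ) n 0 x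
  simpa [chebT, chebT', chebT''] using this

theorem chebT'_le_sq_mul_chebT (n : ℕ) {x : ℝ} (hx : 1 ≤ x) :
    chebT' n x ≤ (n : ℝ) ^ 2 * chebT n x := by
  have h := chebyshev_ode n x
  have h1 := (sq_nonneg (n : ℝ)).trans (sq_le_chebT' n hx)
  have h2 : 0 ≤ chebT'' n x := by
    rcases n with _ | _ | n
    · simp [chebT'']
    · simp [chebT'']
    · exact (chebT''_pos (by omega) hx).le
  nlinarith [mul_nonneg (by nlinarith : 0 ≤ x ^ 2 - 1) h2, mul_nonneg (sub_nonneg.2 hx) h1]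

theorem chebyshev_pell (n : ℕ) {x : ℝ} (hx : 1 ≤ x) :
    (x ^ 2 - 1) * chebT' n x ^ 2 = (n : ℝ) ^ 2 * (chebT n x ^ 2 - 1) := by
  have h := Polynomial.Chebyshev.U_real_cosh (Real.arcosh x) ((n : ℤ) - 1)
  have hT := Polynomial.Chebyshev.T_real_cosh (Real.arcosh x) (n : ℤ)
  have hθ := Real.cosh_sq (Real.arcosh x)
  have hnθ := Real.cosh_sq (n * Real.arcosh x)
  push_cast at h hT
  rw [sub_add_cancel, Real.cosh_arcosh hx] at h
  rw [Real.cosh_arcosh hx] at hT hθ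
  have hT' : chebT' n x = n * (Polynomial.Chebyshev.U ℝ (n - 1)).eval x := by
    simp [chebT', Polynomial.Chebyshev.T_derivative_eq_U]
  rw [hT', chebT, hT, hnθ, hθ, ← h]
  ring

/-- This is a_j ≥ 0 for the second-order coefficients. Multiplied by x² - 1, the differential
equation and the Pell identity reduce it to n² ≤ x T T'. That factor vanishes at x = 1, where
explicit values are used. -/
theorem chebT_mul_chebT''_le (n : ℕ) {x : ℝ} (hx : 1 ≤ x) :
    chebT n x * chebT'' n x ≤ chebT' n x ^ 2 := by
  rcases hx.eq_or_lt with rfl | hx'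
  · have h := Polynomial.Chebyshev.iterate_derivative_T_eval_one_recurrence (R := ℝ) n 1
    have h1 : chebT' n 1 = (n : ℝ) ^ 2 := by
      simpa [chebT'] using Polynomial.Chebyshev.derivative_T_eval_one (R := ℝ) n
    have h2 : (2 + 1) * chebT'' n 1 = ((n : ℝ) ^ 2 - 1) * chebT' n 1 := by
      simpa [chebT', chebT''] using h
    have h3 : chebT n 1 = 1 := by simp [chebT]
    rw [h3, h1] at *
    nlinarith [sq_nonneg (n : ℝ), sq_nonneg ((n : ℝ) ^ 2)]
  · have hode := chebyshev_ode n x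
    have hpell := chebyshev_pell n hx
    have h1 := sq_le_chebT' n hx
    have h2 := one_le_chebT n hx
    have h3 : (n : ℝ) ^ 2 ≤ x * (chebT n x * chebT' n x) := by
      have : chebT' n x ≤ chebT n x * chebT' n x :=
        le_mul_of_one_le_left ((sq_nonneg _).trans h1) h2
      nlinarith [sq_nonneg (n : ℝ)]
    refine le_of_mul_le_mul_left ?_ (by nlinarith : 0 < x ^ 2 - 1)
    linear_combination h3 - chebT n x * hode - hpell

/-- For solutions of the Chebyshev recurrence with positive initial Wronskian, the logarithmic
derivative increases with the index. -/
theorem derivative_ratio_mono_of_recurrence {p q : ℕ → ℝ} {x : ℝ}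
    (hp : ∀ n, p (n + 2) = 2 * x * p (n + 1) - p n)
    (hq : ∀ n, q (n + 2) = 2 * x * q (n + 1) - q n + 2 * p (n + 1))
    (hpos : ∀ n, 0 < p n) (h0 : 0 ≤ q 1 * p 0 - p 1 * q 0) :
    Monotone fun n => q n / p n := by
  -- Each step of the recurrence increases this Wronskian by 2 p(n+1)².
  have hW : ∀ n, 0 ≤ q (n + 1) * p n - p (n + 1) * q n := by
    intro n
    induction n with
    | zero => simpa using h0
    | succ n ih =>
      rw [hp, hq]
      nlinarith [sq_nonneg (p (n + 1))]
  refine monotone_nat_of_le_succ fun n => ?_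
  rw [div_le_div_iff₀ (hpos _) (hpos _)]
  nlinarith [hW n]

theorem chebT'_div_chebT_mono {x : ℝ} (hx : 1 ≤ x) : Monotone fun n => chebT' n x / chebT n x :=
  derivative_ratio_mono_of_recurrence (chebT_add_two · x) (chebT'_add_two · x)
    (fun n => chebT_pos n hx) (by simp [chebT'_one, chebT'_zero, chebT_zero])

/-- Since T_n' = n U_{n-1}, the factor n cancels in the ratio, and U obeys the Chebyshev recurrence
that T' does not. -/
theorem chebT''_div_chebT'_mono {x : ℝ} (hx : 1 ≤ x) {m n : ℕ} (hm : 1 ≤ m) (hmn : m ≤ n) :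
    chebT'' m x / chebT' m x ≤ chebT'' n x / chebT' n x := by
  have h : Monotone fun n : ℕ =>
      (Polynomial.derivative (Polynomial.Chebyshev.U ℝ n)).eval x / chebU n x :=
    derivative_ratio_mono_of_recurrence (chebU_add_two · x)
      (fun n => by simp [chebU, Polynomial.Chebyshev.U_add_two]; ring)
      (fun n => chebU_pos n hx) (by simp [chebU_zero])
  have e (k : ℕ) : chebT'' (k + 1) x / chebT' (k + 1) x =
      (Polynomial.derivative (Polynomial.Chebyshev.U ℝ k)).eval x / chebU k x := by
    have : chebT'' (k + 1) x =
        (k + 1) * (Polynomial.derivative (Polynomial.Chebyshev.U ℝ k)).eval x := by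
      simp [chebT'', Polynomial.Chebyshev.T_derivative_eq_U]
    rw [chebT'_succ, this, mul_div_mul_left _ _ (by positivity)]
  obtain ⟨m, rfl⟩ := Nat.exists_eq_add_of_le' hm
  obtain ⟨n, rfl⟩ := Nat.exists_eq_add_of_le' (hm.trans hmn)
  rw [e, e]
  exact h (by omega)

/-! ### Polynomials of symmetric operators. -/

section SelfAdjoint

variable {E : Type*} [NormedAddCommGroup E] [InnerProductSpace ℝ E] [FiniteDimensional ℝ E]

open Polynomial in
/-- A polynomial of a symmetric operator is bounded by its values near the eigenvalues. -/
theorem norm_aeval_apply_le_of_isSymmetric {W : E →L[ℝ] E}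
    (hW : (W : E →ₗ[ℝ] E).IsSymmetric) {r M : ℝ}
    (hr : ∀ t, Module.End.HasEigenvalue (W : E →ₗ[ℝ] E) t → |t| ≤ r) {p : ℝ[X]}
    (hp : ∀ t, |t| ≤ r → |p.eval t| ≤ M) (hM : 0 ≤ M) (v : E) :
    ‖aeval W p v‖ ≤ M * ‖v‖ := by
  let B := hW.eigenvectorBasis rfl
  let t := hW.eigenvalues rfl
  have hrepr : ∀ (p : ℝ[X]) (v : E) i, B.repr (aeval W p v) i = p.eval (t i) * B.repr v i := by
    intro p
    induction p using Polynomial.induction_on' with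
    | add p q hp hq =>
      intro v i
      simp [hp, hq, add_mul]
    | monomial k a =>
      induction k with
      | zero =>
        intro v i
        simp [Algebra.algebraMap_eq_smul_one]
      | succ k ih =>
        intro v i
        have h1 := hW.eigenvectorBasis_apply_self_apply rfl v i
        have h2 := ih (W v) i
        rw [← monomial_mul_X, map_mul, aeval_X, mul_apply_eq_comp, h2, eval_mul, eval_X,
          mul_assoc]
        exact congr_arg _ h1
  refine le_of_sq_le_sq ?_ (by positivity)
  rw [← B.repr.norm_map, ← B.repr.norm_map v, mul_pow, EuclideanSpace.norm_sq_eq,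
    EuclideanSpace.norm_sq_eq, Finset.mul_sum]
  refine Finset.sum_le_sum fun i _ => ?_
  rw [hrepr, norm_mul, mul_pow]
  gcongr
  exact hp _ (hr _ (hW.hasEigenvalue_eigenvalues rfl i))

/-- The eigenvalues of a nonpositive operator lie between minus its spectral radius and zero. -/
theorem eigenvalue_mem_Icc_of_neg_isPositive {J : E →L[ℝ] E} (hJ : (-J).IsPositive) {t : ℝ}
    (ht : Module.End.HasEigenvalue (J : E →ₗ[ℝ] E) t) :
    t ∈ Set.Icc (-(spectralRadius ℝ J).toReal) 0 := by
  obtain ⟨v, hv⟩ := ht.exists_hasEigenvector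
  have hJv : J v = t • v := hv.apply_eq_smul
  have hv0 : v ≠ 0 := hv.2
  have : Nontrivial E := ⟨v, 0, hv0⟩
  constructor
  · have hmem : t ∈ spectrum ℝ J := by
      intro hu
      rw [resolventSet, Set.mem_ofPred_eq] at hu
      obtain ⟨u, hu⟩ := hu
      have h0 : (u : E →L[ℝ] E) v = 0 := by
        rw [hu, sub_apply, hJv, Algebra.algebraMap_eq_smul_one]
        simp
      have h1 : ((↑u⁻¹ : E →L[ℝ] E) * ↑u) v = v := by simp
      rw [mul_apply_eq_comp, h0, map_zero] at h1
      exact hv0 h1.symm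
    have h1 : (‖t‖₊ : ENNReal) ≤ spectralRadius ℝ J := le_iSup₂ (α := ENNReal) t hmem
    -- Finiteness matters because `ENNReal.toReal` sends ⊤ to 0.
    have h2 : spectralRadius ℝ J ≠ ⊤ :=
      ((spectrum.spectralRadius_le_nnnorm J).trans_lt ENNReal.coe_lt_top).ne
    have h3 := ENNReal.toReal_mono h2 h1
    rw [ENNReal.coe_toReal, coe_nnnorm, Real.norm_eq_abs] at h3
    exact neg_le.1 ((neg_le_abs t).trans h3)
  · have h := hJ.2 v
    rw [ContinuousLinearMap.reApplyInnerSelf_apply, neg_apply, hJv,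
      inner_neg_left, inner_smul_left] at h
    have h' : 0 < inner ℝ v v := real_inner_self_pos.2 hv0
    simp only [conj_trivial, map_neg, RCLike.re_to_real] at h
    nlinarith

end SelfAdjoint

/-! ### Variation of constants and Taylor remainder. -/

open Polynomial in
/-- Variation of constants for the Chebyshev recurrence. -/
theorem chebyshev_recurrence_solution {A M : Type*} [Ring A] [Algebra ℝ A] [AddCommGroup M]
    [Module A M] (w : A) {z q : ℕ → M} (h0 : z 0 = 0) (h1 : z 1 = q 1)
    (h2 : ∀ j, z (j + 2) = (2 * w) • z (j + 1) - z j + q (j + 2)) (j : ℕ) :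
    z j = ∑ i ∈ Finset.Icc 1 j, aeval w (Chebyshev.U ℝ ((j - i : ℕ) : ℤ)) • q i := by
  -- With integer indices the boundary terms need no separate treatment: U_{-1} = 0 and U_{-2} = -1
  -- produce exactly the new source term.
  have key : ∀ j : ℕ, z j = ∑ i ∈ Finset.range j,
      aeval w (Chebyshev.U ℝ ((j : ℤ) - (i + 1))) • q (i + 1) := by
    intro j
    induction j using Nat.twoStepInduction with
    | zero => simp [h0]
    | one => simp [h1]
    | more j ih ih' =>
      have hU (i : ℕ) : aeval w (Chebyshev.U ℝ (((j + 2 : ℕ) : ℤ) - (i + 1))) • q (i + 1) =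
          (2 * w) • aeval w (Chebyshev.U ℝ (((j + 1 : ℕ) : ℤ) - (i + 1))) • q (i + 1) -
            aeval w (Chebyshev.U ℝ ((j : ℤ) - (i + 1))) • q (i + 1) := by
        have := Chebyshev.U_add_two ℝ ((j : ℤ) - (i + 1))
        rw [show ((j + 2 : ℕ) : ℤ) - (i + 1) = (j : ℤ) - (i + 1) + 2 by push_cast; ring, this,
          show ((j + 1 : ℕ) : ℤ) - (i + 1) = (j : ℤ) - (i + 1) + 1 by push_cast; ring,
          smul_smul, ← sub_smul]
        simp [map_ofNat]
      rw [h2, ih', ih, Finset.sum_congr rfl fun i _ => hU i, Finset.sum_sub_distrib,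
        ← Finset.smul_sum, Finset.sum_range_succ _ (j + 1), Finset.sum_range_succ _ (j + 1),
        Finset.sum_range_succ (fun i : ℕ =>
          aeval w (Chebyshev.U ℝ ((j : ℤ) - (i + 1))) • q (i + 1)) j]
      have e1 : ((j + 1 : ℕ) : ℤ) - (((j + 1 : ℕ) : ℤ) + 1) = -1 := by ring
      have e2 : (j : ℤ) - ((j : ℤ) + 1) = -1 := by ring
      have e3 : (j : ℤ) - (((j + 1 : ℕ) : ℤ) + 1) = -2 := by push_cast; ring
      rw [e1, e2, e3, Chebyshev.U_neg_one, Chebyshev.U_neg_two]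
      simp only [zero_smul, neg_smul, map_neg, map_one, map_zero, one_smul, add_zero]
      abel
  rw [key, show Finset.Icc 1 j = Finset.Ico 1 (j + 1) from rfl, Finset.sum_Ico_eq_sum_range,
    Nat.add_sub_cancel]
  refine Finset.sum_congr rfl fun i hi => ?_
  have hi := Finset.mem_range.1 hi
  rw [Nat.cast_sub (by omega), add_comm 1 i]
  push_cast
  rfl

/-- The derivative `T_j'` as a combination of the `U_{j-i}`. -/
theorem sum_chebU_mul_chebT (x : ℝ) (j : ℕ) :
    ∑ i ∈ Finset.Icc 1 j, chebU (j - i) x * (if i = 1 then 1 else 2 * chebT (i - 1) x) =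
      chebT' j x := by
  have := chebyshev_recurrence_solution x (z := fun j => chebT' j x)
    (q := fun i => if i = 1 then 1 else 2 * chebT (i - 1) x) (chebT'_zero x)
    (by simp [chebT'_one]) (fun j => by simp [chebT'_add_two]) j
  simpa [chebU, Polynomial.coe_aeval_eq_eval] using this.symm

/-- A function with a `C`-Lipschitz derivative is approximated by its linearisation up to
`C ‖d‖² / 2`. -/
theorem norm_sub_sub_fderiv_le {E F : Type*} [NormedAddCommGroup E] [NormedSpace ℝ E]
    [NormedAddCommGroup F] [NormedSpace ℝ F] {f : E → F} {C : ℝ} (hf : Differentiable ℝ f)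
    (hC : ∀ x y, ‖fderiv ℝ f x - fderiv ℝ f y‖ ≤ C * ‖x - y‖) (y d : E) :
    ‖f (y + d) - f y - fderiv ℝ f y d‖ ≤ C / 2 * ‖d‖ ^ 2 := by
  let φ : ℝ → F := fun t => f (y + t • d) - f y - t • fderiv ℝ f y d
  have hφ (t : ℝ) : HasDerivAt φ (fderiv ℝ f (y + t • d) d - fderiv ℝ f y d) t := by
    have h1 : HasDerivAt (fun t : ℝ => y + t • d) d t := by
      simpa using ((hasDerivAt_id t).smul_const d).const_add y
    have h2 := (hf (y + t • d)).hasFDerivAt.comp_hasDerivAt t h1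
    have h3 : HasDerivAt (fun t : ℝ => t • fderiv ℝ f y d) (fderiv ℝ f y d) t := by
      simpa using (hasDerivAt_id t).smul_const (fderiv ℝ f y d)
    exact (h2.sub_const (f y)).sub h3
  have hB (t : ℝ) : HasDerivAt (fun t : ℝ => C / 2 * ‖d‖ ^ 2 * t ^ 2) (C * ‖d‖ ^ 2 * t) t :=
    ((hasDerivAt_pow 2 t).const_mul (C / 2 * ‖d‖ ^ 2)).congr_deriv (by norm_num; ring)
  have := image_norm_le_of_norm_deriv_right_le_deriv_boundary (a := 0) (b := 1)
    (fun t _ => (hφ t).continuousAt.continuousWithinAt) (fun t _ => (hφ t).hasDerivWithinAt)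
    (B := fun t : ℝ => C / 2 * ‖d‖ ^ 2 * t ^ 2) (B' := fun t => C * ‖d‖ ^ 2 * t) (by simp [φ]) hB
    (fun t ht => ?_) (Set.right_mem_Icc.2 zero_le_one)
  · simpa [φ] using this
  · rw [← sub_apply]
    refine (ContinuousLinearMap.le_opNorm _ _).trans ?_
    have := hC (y + t • d) y
    rw [add_sub_cancel_left, norm_smul, Real.norm_of_nonneg ht.1] at this
    nlinarith [norm_nonneg d, mul_le_mul_of_nonneg_right this (norm_nonneg d)]

/-! ### Admissible coefficients and the stage constant. -/

/-- The properties of Runge–Kutta–Chebyshev coefficients on which the error analysis rests. -/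
structure RKCCoeffs.Admissible (C : RKCCoeffs) (s : ℕ) (K : ℝ) : Prop where
  one_le_ω₀ : 1 ≤ C.ω₀
  ω₁_pos : 0 < C.ω₁
  b_pos : ∀ j, 0 < C.b j
  b_mul_chebT_le : ∀ j ≤ s, C.b j * chebT j C.ω₀ ≤ 1
  one_le : 1 ≤ K
  le_b_mul_chebT : ∀ j < s, 1 ≤ K * (C.b j * chebT j C.ω₀)
  b_mul_chebT'_le : ∀ j ≤ s, C.b j * C.ω₁ * chebT' j C.ω₀ ≤ 1

namespace RKCCoeffs

theorem μ_one (C : RKCCoeffs) : C.μ 1 = C.b 1 * C.ω₁ := by simp [μ]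

theorem μ_of_two_le (C : RKCCoeffs) {j : ℕ} (hj : 2 ≤ j) :
    C.μ j = 2 * C.ω₁ * C.b j / C.b (j - 1) := by
  simp [μ, show j ≠ 1 by omega]

namespace Admissible

variable {C : RKCCoeffs} {s : ℕ} {K : ℝ}

theorem μ_pos (hC : C.Admissible s K) (j : ℕ) : 0 < C.μ j := by
  have h1 := hC.ω₁_pos
  have h2 := hC.b_pos
  unfold RKCCoeffs.μ
  split_ifs
  · exact mul_pos (h2 1) h1
  · exact div_pos (mul_pos (by linarith) (h2 j)) (h2 _)

theorem stageConst_term_nonneg (hC : C.Admissible s K) (i j : ℕ) :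
    0 ≤ C.b j / C.b i * chebU (j - i) C.ω₀ * C.μ i :=
  mul_nonneg (mul_nonneg (div_pos (hC.b_pos j) (hC.b_pos i)).le (chebU_pos _ hC.one_le_ω₀).le)
    (hC.μ_pos i).le

theorem stageConst_nonneg (hC : C.Admissible s K) (j : ℕ) : 0 ≤ rkcStageConst C j :=
  Finset.sum_nonneg fun _ _ => hC.stageConst_term_nonneg _ _

/-- Termwise comparison with the expansion of T_j' in `sum_chebU_mul_chebT`: in μ_i the factor
1/b_{i-1} is at most K T_{i-1}(ω₀). -/
theorem stageConst_le_mul (hC : C.Admissible s K) {j : ℕ} (hj : j ≤ s) :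
    rkcStageConst C j ≤ K * (C.b j * C.ω₁ * chebT' j C.ω₀) := by
  rw [rkcStageConst, ← sum_chebU_mul_chebT, Finset.mul_sum, Finset.mul_sum]
  refine Finset.sum_le_sum fun i hi => ?_
  have hi := Finset.mem_Icc.1 hi
  have hU := (chebU_pos (j - i) hC.one_le_ω₀).le
  have hb := hC.b_pos
  have hω := hC.ω₁_pos
  split_ifs with h1
  · subst h1
    have h2 : 0 ≤ C.b j * C.ω₁ * chebU (j - 1) C.ω₀ :=
      mul_nonneg (mul_pos (hb j) hω).le hU
    rw [μ_one]
    calc C.b j / C.b 1 * chebU (j - 1) C.ω₀ * (C.b 1 * C.ω₁)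
        = 1 * (C.b j * C.ω₁ * chebU (j - 1) C.ω₀) := by
          field_simp [(hb 1).ne']
      _ ≤ K * (C.b j * C.ω₁ * chebU (j - 1) C.ω₀) := mul_le_mul_of_nonneg_right hC.one_le h2
      _ = _ := by ring
  · have h3 := hC.le_b_mul_chebT (i - 1) (by omega)
    have hbi := hb (i - 1)
    rw [μ_of_two_le C (by omega)]
    have h2 : 0 ≤ 2 * C.b j * C.ω₁ * chebU (j - i) C.ω₀ / C.b (i - 1) :=
      div_nonneg (mul_nonneg (mul_pos (mul_pos two_pos (hb j)) hω).le hU) hbi.le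
    have hbi' := hb i
    calc C.b j / C.b i * chebU (j - i) C.ω₀ * (2 * C.ω₁ * C.b i / C.b (i - 1))
        = (2 * C.b j * C.ω₁ * chebU (j - i) C.ω₀ / C.b (i - 1)) * 1 := by
          field_simp
      _ ≤ _ * _ := mul_le_mul_of_nonneg_left h3 h2
      _ = _ := by field_simp

theorem stageConst_le (hC : C.Admissible s K) {j : ℕ} (hj : j ≤ s) : rkcStageConst C j ≤ K :=
  (hC.stageConst_le_mul hj).trans <|
    mul_le_of_le_one_right (zero_le_one.trans hC.one_le) (hC.b_mul_chebT'_le j hj)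

end Admissible

end RKCCoeffs

/-! ### Stability of the perturbed stage recurrence. -/

section StageBound

variable {E : Type*} [NormedAddCommGroup E] [NormedSpace ℝ E]

open Polynomial in
/-- Solutions of the RKC stage recurrence whose increments are linear with operator `J` up to the
perturbations `e i`. -/
theorem norm_add_stage_le {C : RKCCoeffs} {s : ℕ} {K : ℝ} (hC : C.Admissible s K)
    {Δt : ℝ} (hΔt : 0 ≤ Δt) {J W : E →L[ℝ] E} (hW : W = C.ω₀ • 1 + (C.ω₁ * Δt) • J)
    (hT : ∀ (k : ℕ) v, ‖aeval W (Chebyshev.T ℝ k) v‖ ≤ chebT k C.ω₀ * ‖v‖)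
    (hU : ∀ (k : ℕ) v, ‖aeval W (Chebyshev.U ℝ k) v‖ ≤ chebU k C.ω₀ * ‖v‖)
    {x e : ℕ → E} {v h : E} (x0 : x 0 = 0) (x1 : x 1 = (C.μ 1 * Δt) • (J v + h))
    (x2 : ∀ j, x (j + 2) = C.ν (j + 2) • x (j + 1) + C.κ (j + 2) • x j
      + (C.μ (j + 2) * Δt) • (J v + h + (J (x (j + 1)) + e (j + 1)))
      + (C.γ (j + 2) * Δt) • (J v + h))
    {j : ℕ} (hj : j ≤ s) {M : ℝ} (hM : 0 ≤ M) (he : ∀ i, 1 ≤ i → i < j → ‖e i‖ ≤ M) :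
    ‖v + x j‖ ≤ ‖v‖ + C.b j * C.ω₁ * chebT' j C.ω₀ * (Δt * ‖h‖)
      + rkcStageConst C j * (Δt * M) := by
  have hb := hC.b_pos
  have hω := hC.ω₁_pos
  have hWv (u : E) : W u = C.ω₀ • u + (C.ω₁ * Δt) • J u := by simp [hW]
  -- Subtracting (T_j(W) - T_j(ω₀)) v, the exact response to the drive J v, leaves a sequence
  -- started at 0 and driven only by h and e.
  let z : ℕ → E := fun j =>
    (C.b j)⁻¹ • x j - (aeval W (Chebyshev.T ℝ j) v - chebT j C.ω₀ • v)
  -- The weight T_{i-1}(ω₀) of h comes from μ_i + γ_i = μ_i b_{i-1} T_{i-1}(ω₀).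
  let q : ℕ → E := fun i => if i = 1 then (C.ω₁ * Δt) • h else
    (2 * C.ω₁ * Δt) • (chebT (i - 1) C.ω₀ • h + (C.b (i - 1))⁻¹ • e (i - 1))
  have z0 : z 0 = 0 := by simp [z, x0, chebT_zero]
  have z1 : z 1 = q 1 := by
    have := (hb 1).ne'
    simp only [z, q, x1, chebT_one, C.μ_one, Nat.cast_one, Chebyshev.T_one, aeval_X, hWv, if_true]
    match_scalars <;> field_simp <;> ring
  have z2 : ∀ j, z (j + 2) = (2 * W) • z (j + 1) - z j + q (j + 2) := by
    intro j
    have h0 := (hb j).ne'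
    have h1 := (hb (j + 1)).ne'
    have h2 := (hb (j + 2)).ne'
    have hTv : aeval W (Chebyshev.T ℝ ((j + 2 : ℕ) : ℤ)) v =
        (2 : ℝ) • W (aeval W (Chebyshev.T ℝ ((j + 1 : ℕ) : ℤ)) v) -
          aeval W (Chebyshev.T ℝ (j : ℤ)) v := by
      push_cast
      rw [Chebyshev.T_add_two, show (2 * X : ℝ[X]) = (2 : ℝ) • X by
        rw [smul_eq_C_mul]; rfl]
      simp
    have h2W (u : E) : (2 * W) • u = (2 : ℝ) • W u := by
      rw [two_mul, add_smul, two_smul]; rfl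
    simp only [z, q, x2, hTv, h2W, hWv, map_sub, map_smul, chebT_add_two, RKCCoeffs.ν, RKCCoeffs.κ,
      RKCCoeffs.γ, RKCCoeffs.a, C.μ_of_two_le (Nat.le_add_left 2 j), Nat.add_sub_cancel,
      show j + 2 - 1 = j + 1 from rfl, show j + 2 ≠ 1 by omega, if_false]
    match_scalars <;> field_simp <;> ring
  have hz := chebyshev_recurrence_solution W z0 z1 z2 j
  have hx : v + x j = (1 - C.b j * chebT j C.ω₀) • v
      + C.b j • aeval W (Chebyshev.T ℝ j) v + C.b j • z j := by
    have := (hb j).ne'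
    simp only [z]
    match_scalars <;> field_simp <;> ring
  have hzj : C.b j * ‖z j‖ ≤ C.b j * C.ω₁ * chebT' j C.ω₀ * (Δt * ‖h‖)
      + rkcStageConst C j * (Δt * M) := by
    rw [hz, rkcStageConst, ← sum_chebU_mul_chebT, Finset.mul_sum, Finset.sum_mul, Finset.sum_mul,
      ← Finset.sum_add_distrib]
    refine (mul_le_mul_of_nonneg_left (norm_sum_le _ _) (hb j).le).trans ?_
    rw [Finset.mul_sum]
    refine Finset.sum_le_sum fun i hi => ?_
    have hi := Finset.mem_Icc.1 hi
    have hU0 := (chebU_pos (j - i) hC.one_le_ω₀).le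
    refine (mul_le_mul_of_nonneg_left (hU (j - i) (q i)) (hb j).le).trans ?_
    simp only [q]
    split_ifs with h1
    · refine le_add_of_le_of_nonneg (le_of_eq ?_)
        (mul_nonneg (hC.stageConst_term_nonneg _ _) (mul_nonneg hΔt hM))
      rw [norm_smul, Real.norm_of_nonneg (mul_nonneg hω.le hΔt)]
      ring
    · have hbi := hb i
      have hbi' := hb (i - 1)
      have hT0 := (chebT_pos (i - 1) hC.one_le_ω₀).le
      have hq : ‖(2 * C.ω₁ * Δt) • (chebT (i - 1) C.ω₀ • h + (C.b (i - 1))⁻¹ • e (i - 1))‖ ≤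
          2 * C.ω₁ * Δt * (chebT (i - 1) C.ω₀ * ‖h‖ + (C.b (i - 1))⁻¹ * M) := by
        rw [norm_smul, Real.norm_of_nonneg (by positivity)]
        gcongr
        refine (norm_add_le _ _).trans (add_le_add ?_ ?_)
        · rw [norm_smul, Real.norm_of_nonneg hT0]
        · rw [norm_smul, Real.norm_of_nonneg (inv_pos.2 hbi').le]
          gcongr
          exact he _ (by omega) (by omega)
      rw [C.μ_of_two_le (by omega)]
      refine (mul_le_mul_of_nonneg_left (mul_le_mul_of_nonneg_left hq hU0) (hb j).le).trans
        (le_of_eq ?_)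
      field_simp
  have hbT := hC.b_mul_chebT_le j hj
  rw [hx]
  refine (norm_add₃_le).trans ?_
  rw [norm_smul, norm_smul, norm_smul, Real.norm_of_nonneg (sub_nonneg.2 hbT),
    Real.norm_of_nonneg (hb j).le]
  have := mul_le_mul_of_nonneg_left (hT j v) (hb j).le
  linarith

end StageBound

/-! ### RKC1 and RKC2 coefficients are admissible. -/

theorem one_le_one_add_div_sq {ε : ℝ} (hε : 0 ≤ ε) (s : ℕ) : 1 ≤ 1 + ε / (s : ℝ) ^ 2 :=
  le_add_of_nonneg_right (by positivity)

theorem rkc1_admissible {s : ℕ} (hs : 1 ≤ s) {ε : ℝ} (hε : 0 ≤ ε) :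
    (rkc1 s ε).Admissible s 1 := by
  have hx := one_le_one_add_div_sq hε s
  have hT (j : ℕ) := chebT_pos j hx
  have hT' := chebT'_pos hs hx
  constructor
  · exact hx
  · exact div_pos (hT s) hT'
  · exact fun j => one_div_pos.2 (hT j)
  · exact fun j _ => (one_div_mul_cancel (hT j).ne').le
  · exact le_rfl
  · intro j _
    rw [one_mul]
    exact (one_div_mul_cancel (hT j).ne').ge
  · intro j hj
    have h := chebT'_div_chebT_mono hx hj
    simp only at h
    have hs' := hT s
    have hj' := hT j
    rw [div_le_div_iff₀ hj' hs'] at h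
    simp only [rkc1]
    rw [div_mul_div_comm, div_mul_eq_mul_div, div_le_one (by positivity)]
    linarith

/-- With δ = ε/s², `sq_mul_chebT_le` bounds ω₁ β by 2 (1 - 2ε/3)(1 + 2ε/3 + δ/3), and the terms
linear in ε cancel. -/
theorem rkc1_ω₁_mul_β_le {s : ℕ} (hs : 1 ≤ s) {ε : ℝ} (hε : 0 ≤ ε) (hβ : 0 ≤ rkcβ1 s ε) :
    (rkc1 s ε).ω₁ * rkcβ1 s ε ≤ 2 * (rkc1 s ε).ω₀ := by
  have hx := one_le_one_add_div_sq hε s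
  have hT' := chebT'_pos hs hx
  have hs0 : (0 : ℝ) < s := by exact_mod_cast hs
  have key := sq_mul_chebT_le hs hx
  have hε' : 0 ≤ 1 - 2 / 3 * ε := by
    have := nonneg_of_mul_nonneg_left hβ (by positivity)
    linarith
  simp only [rkc1, rkcβ1]
  rw [div_mul_eq_mul_div, div_le_iff₀ hT']
  have hδ : ε = ε / (s : ℝ) ^ 2 * (s : ℝ) ^ 2 := by field_simp
  have hδ0 : 0 ≤ ε / (s : ℝ) ^ 2 := by positivity
  set δ := ε / (s : ℝ) ^ 2
  have h1 : (1 - 2 / 3 * ε) * (1 + (2 * (s : ℝ) ^ 2 + 1) / 3 * (1 + δ - 1)) ≤ 1 + δ := by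
    have : (2 * (s : ℝ) ^ 2 + 1) / 3 * (1 + δ - 1) = 2 / 3 * ε + δ / 3 := by
      linear_combination -(2 / 3) * hδ
    rw [this]
    nlinarith [sq_nonneg ε, mul_nonneg hε hδ0]
  nlinarith [mul_le_mul_of_nonneg_left key hε', mul_le_mul_of_nonneg_right h1 hT'.le]

theorem rkc2_b_of_two_le (s : ℕ) (ε : ℝ) {j : ℕ} (hj : 2 ≤ j) :
    (rkc2 s ε).b j = chebT'' j (rkc2 s ε).ω₀ / chebT' j (rkc2 s ε).ω₀ ^ 2 := by
  simp [rkc2, max_eq_left hj]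

theorem rkc2_b_of_le_two {s : ℕ} {ε : ℝ} (hx : (rkc2 s ε).ω₀ ≠ 0) {j : ℕ} (hj : j ≤ 2) :
    (rkc2 s ε).b j = 1 / (4 * (rkc2 s ε).ω₀ ^ 2) := by
  have : (rkc2 s ε).b j = chebT'' 2 (rkc2 s ε).ω₀ / chebT' 2 (rkc2 s ε).ω₀ ^ 2 := by
    simp [rkc2, max_eq_right hj]
  rw [this, chebT''_two, chebT'_two]
  field_simp

theorem two_mul_sq_add_seven_div_mul_le {j s : ℕ} (hs : 2 ≤ s) (hj : j ≤ s) {ε : ℝ} (hε : 0 ≤ ε) :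
    (2 * (j : ℝ) ^ 2 + 7) / 15 * (ε / (s : ℝ) ^ 2) ≤ ε / 4 := by
  have hs' : (2 : ℝ) ≤ s := by exact_mod_cast hs
  have hj' : (j : ℝ) ≤ s := by exact_mod_cast hj
  rw [div_mul_div_comm, div_le_div_iff₀ (by positivity) (by positivity)]
  have : (j : ℝ) ^ 2 ≤ (s : ℝ) ^ 2 := by gcongr
  -- Sharp at j = s = 2, whence the constant ε/4.
  have : (2 * (j : ℝ) ^ 2 + 7) * 4 ≤ 15 * (s : ℝ) ^ 2 := by nlinarith
  linarith [mul_le_mul_of_nonneg_right this hε]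

/-- For 2 ≤ j < s, T_j'' ≥ (j²/4) T_j' / (1 + ε/4) and T_j' ≤ j² T_j give 4 (1 + ε/4) b_j T_j(ω₀) ≥
1. The square in K is for j = 0, 1, where b_j = 1/(4 ω₀²) and ω₀ ≤ 1 + ε/4. -/
theorem rkc2_admissible {s : ℕ} (hs : 2 ≤ s) {ε : ℝ} (hε : 0 ≤ ε) :
    (rkc2 s ε).Admissible s (4 * (1 + ε / 4) ^ 2) := by
  have hx : 1 ≤ (rkc2 s ε).ω₀ := one_le_one_add_div_sq hε s
  have hω₁ : (rkc2 s ε).ω₁ = chebT' s (rkc2 s ε).ω₀ / chebT'' s (rkc2 s ε).ω₀ := rfl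
  have hb2 {j : ℕ} (hj : j ≤ 2) := rkc2_b_of_le_two (by linarith) hj (s := s) (ε := ε)
  have hb {j : ℕ} (hj : 2 ≤ j) := rkc2_b_of_two_le s ε hj
  have hx1 : (rkc2 s ε).ω₀ - 1 = ε / (s : ℝ) ^ 2 := by simp [rkc2]
  have hδ : ε / (s : ℝ) ^ 2 ≤ ε / 4 := by
    have hs' : (2 : ℝ) ≤ s := by exact_mod_cast hs
    gcongr
    nlinarith
  generalize hxd : (rkc2 s ε).ω₀ = x at *
  have hT (j : ℕ) := chebT_pos j hx
  have hT's := chebT'_pos (by omega : 1 ≤ s) hx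
  have hT''s := chebT''_pos hs hx
  have hx0 : 0 < x := by linarith
  have hx2 : 1 ≤ x ^ 2 := one_le_pow₀ hx
  constructor <;> (try simp only [hxd])
  · exact hx
  · rw [hω₁]
    exact div_pos hT's hT''s
  · intro j
    rcases le_total j 2 with hj | hj
    · rw [hb2 hj]
      positivity
    · rw [hb hj]
      exact div_pos (chebT''_pos hj hx) (pow_pos (chebT'_pos (by omega) hx) 2)
  · intro j _
    rcases lt_or_ge j 2 with hj | hj
    · rw [hb2 hj.le, div_mul_eq_mul_div, one_mul, div_le_one (by positivity)]
      interval_cases j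
      · rw [chebT_zero]
        linarith
      · rw [chebT_one]
        nlinarith
    · rw [hb hj, div_mul_eq_mul_div, div_le_one (pow_pos (chebT'_pos (by omega) hx) 2), mul_comm]
      exact chebT_mul_chebT''_le j hx
  · nlinarith
  · intro j hjs
    rcases lt_or_ge j 2 with hj | hj
    · have hxε : x ≤ 1 + ε / 4 := by linarith
      have h2 : x ^ 2 ≤ (1 + ε / 4) ^ 2 := by gcongr
      have h3 : 1 ≤ chebT j x := one_le_chebT j hx
      rw [hb2 hj.le, div_mul_eq_mul_div, mul_div_assoc', one_mul, le_div_iff₀ (by positivity)]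
      nlinarith
    · have hj2 : (2 : ℝ) ≤ j := by exact_mod_cast hj
      have hT'j := chebT'_pos (by omega : 1 ≤ j) hx
      have hT''j := chebT''_pos hj hx
      have h1 := sq_sub_one_mul_chebT'_le (by omega : 1 ≤ j) hx
      have h2 := chebT'_le_sq_mul_chebT j hx
      have h3 := two_mul_sq_add_seven_div_mul_le hs hjs.le hε
      rw [← hx1] at h3
      have hTj := hT j
      rw [hb hj, div_mul_eq_mul_div, mul_div_assoc', le_div_iff₀ (by positivity), one_mul]
      generalize chebT j x = t at *
      generalize chebT' j x = t' at *
      generalize chebT'' j x = t'' at *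
      have h4 : (j : ℝ) ^ 2 / 4 * t' ≤ t'' * (1 + ε / 4) := by
        have h5 : (j : ℝ) ^ 2 / 4 * t' ≤ ((j : ℝ) ^ 2 - 1) / 3 * t' :=
          mul_le_mul_of_nonneg_right (by nlinarith) hT'j.le
        have h6 := mul_le_mul_of_nonneg_left h3 hT''j.le
        linarith
      have h7 : (j : ℝ) ^ 2 * t' ^ 2 ≤ (j : ℝ) ^ 2 * (4 * (1 + ε / 4) * (t'' * t)) := by
        have h8 := mul_le_mul_of_nonneg_right h4 (by positivity : 0 ≤ 4 * ((j : ℝ) ^ 2 * t))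
        have h9 := mul_le_mul_of_nonneg_left h2 (by positivity : 0 ≤ (j : ℝ) ^ 2 * t')
        linarith
      have h10 := le_of_mul_le_mul_left h7 (by positivity)
      have h11 : 4 * (1 + ε / 4) * (t'' * t) ≤ 4 * (1 + ε / 4) ^ 2 * (t'' * t) := by
        refine mul_le_mul_of_nonneg_right ?_ (by positivity)
        nlinarith
      exact h10.trans h11
  · intro j hjs
    rw [hω₁]
    rcases lt_or_ge j 2 with hj | hj
    · rw [hb2 hj.le]
      interval_cases j
      · simp [chebT'_zero]
      · have h := chebT''_div_chebT'_mono hx one_le_two hs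
        rw [chebT''_two, chebT'_two, div_le_div_iff₀ (by positivity) hT's] at h
        rw [chebT'_one, mul_one, div_mul_div_comm, one_mul, div_le_one (by positivity)]
        nlinarith [mul_le_mul_of_nonneg_right hx2 hT''s.le,
          mul_le_mul_of_nonneg_right hx hT''s.le]
    · have h := chebT''_div_chebT'_mono hx (by omega) hjs
      have hT'j := chebT'_pos (by omega : 1 ≤ j) hx
      rw [div_le_div_iff₀ hT'j hT's] at h
      rw [hb hj, div_mul_div_comm, div_mul_eq_mul_div, div_le_one (by positivity)]
      nlinarith

theorem rkc2_ω₁_mul_β_le {s : ℕ} (hs : 2 ≤ s) {ε : ℝ} (hε : 0 ≤ ε) (hβ : 0 ≤ rkcβ2 s ε) :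
    (rkc2 s ε).ω₁ * rkcβ2 s ε ≤ 2 * (rkc2 s ε).ω₀ := by
  have hx := one_le_one_add_div_sq hε s
  have hT'' := chebT''_pos hs hx
  have hs0 : (2 : ℝ) ≤ s := by exact_mod_cast hs
  have key := sq_sub_one_mul_chebT'_le (by omega : 1 ≤ s) hx
  have hε' : 0 ≤ 1 - 2 / 15 * ε := by
    have := nonneg_of_mul_nonneg_left hβ (by nlinarith)
    linarith
  simp only [rkc2, rkcβ2]
  rw [div_mul_eq_mul_div, div_le_iff₀ hT'']
  have hδ : ε = ε / (s : ℝ) ^ 2 * (s : ℝ) ^ 2 := by field_simp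
  have hδ0 : 0 ≤ ε / (s : ℝ) ^ 2 := by positivity
  set δ := ε / (s : ℝ) ^ 2
  have h1 : (1 - 2 / 15 * ε) * (1 + (2 * (s : ℝ) ^ 2 + 7) / 15 * (1 + δ - 1)) ≤ 1 + δ := by
    have : (2 * (s : ℝ) ^ 2 + 7) / 15 * (1 + δ - 1) = 2 / 15 * ε + 7 / 15 * δ := by
      linear_combination -(2 / 15) * hδ
    rw [this]
    nlinarith [sq_nonneg ε, mul_nonneg hε hδ0]
  nlinarith [mul_le_mul_of_nonneg_left key hε', mul_le_mul_of_nonneg_right h1 hT''.le]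

/-! ### Spectral localisation and small steps. -/

open Polynomial in
/-- Chebyshev-type bounds for polynomials in the operator `ω₀ + ω₁ Δt J`. -/
theorem norm_aeval_shifted_jacobian_le {n : ℕ} {ω₀ ω₁ Δt β : ℝ} (hω₁ : 0 < ω₁) (hΔt : 0 < Δt)
    (hβ : 0 ≤ β → ω₁ * β ≤ 2 * ω₀) {J W : RKCState n →L[ℝ] RKCState n} (hJ : (-J).IsPositive)
    (hρ : Δt * (spectralRadius ℝ J).toReal ≤ β) (hW : W = ω₀ • 1 + (ω₁ * Δt) • J)
    {p : ℝ[X]} {M : ℝ} (hp : ∀ t, |t| ≤ ω₀ → |p.eval t| ≤ M) (hM : 0 ≤ M) (v : RKCState n) :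
    ‖aeval W p v‖ ≤ M * ‖v‖ := by
  have hWu (u : RKCState n) : W u = ω₀ • u + (ω₁ * Δt) • J u := by simp [hW]
  have hJs : (J : RKCState n →ₗ[ℝ] RKCState n).IsSymmetric := by
    intro u w
    simpa using hJ.isSymmetric u w
  refine norm_aeval_apply_le_of_isSymmetric (r := ω₀) ?_ ?_ hp hM v
  · intro u w
    have := hJs u w
    simp only [ContinuousLinearMap.coe_coe] at this ⊢
    rw [hWu, hWu, inner_add_left, inner_add_right, inner_smul_left, inner_smul_left,
      inner_smul_right, inner_smul_right, this]
    simp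
  · intro t ht
    obtain ⟨u, hu⟩ := ht.exists_hasEigenvector
    have hWt : W u = t • u := hu.apply_eq_smul
    have hc : 0 < ω₁ * Δt := mul_pos hω₁ hΔt
    have hJu : J u = ((t - ω₀) / (ω₁ * Δt)) • u := by
      rw [hWu, ← eq_sub_iff_add_eq', ← sub_smul] at hWt
      rw [div_eq_inv_mul, mul_smul, ← hWt, smul_smul, inv_mul_cancel₀ hc.ne', one_smul]
    have hJt : Module.End.HasEigenvalue (J : RKCState n →ₗ[ℝ] RKCState n)
        ((t - ω₀) / (ω₁ * Δt)) :=
      Module.End.hasEigenvalue_of_hasEigenvector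
        (Module.End.hasEigenvector_iff.2 ⟨Module.End.mem_eigenspace_iff.2 hJu, hu.2⟩)
    obtain ⟨h1, h2⟩ := eigenvalue_mem_Icc_of_neg_isPositive hJ hJt
    have hρ0 : 0 ≤ Δt * (spectralRadius ℝ J).toReal := mul_nonneg hΔt.le ENNReal.toReal_nonneg
    have hβ' := hβ (hρ0.trans hρ)
    rw [le_div_iff₀ hc] at h1
    rw [div_le_iff₀ hc] at h2
    rw [abs_le]
    constructor <;> nlinarith [mul_le_mul_of_nonneg_left hρ hω₁.le]

/-- The exact scheme is the mixed-precision scheme with exact differences. -/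
theorem rkcStage_eq_mpStage {n : ℕ} (C : RKCCoeffs) (Δt : ℝ) (f : RKCState n → RKCState n)
    (y : RKCState n) (j : ℕ) :
    rkcStage C Δt f y j = mpStage C Δt f (fun i => f (y + rkcStage C Δt f y i) - f y) y j := by
  induction j using Nat.twoStepInduction with
  | zero => rfl
  | one => rfl
  | more j ih ih' =>
    rw [rkcStage, mpStage, ← ih, ← ih', add_sub_cancel]

/-- For small step sizes the stage increments are bounded by `2 Δt ‖f y‖`. -/
theorem norm_mpStage_le_two_mul {n : ℕ} {C : RKCCoeffs} {s : ℕ} {K β η : ℝ}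
    (hC : C.Admissible s K) (hβ : 0 ≤ β → C.ω₁ * β ≤ 2 * C.ω₀) (hη : 0 ≤ η) (hKη : 2 * K * η ≤ 1)
    {Δt : ℝ} (hΔt : 0 < Δt) {f : RKCState n → RKCState n} {D : ℕ → RKCState n} {y : RKCState n}
    {L Cd r : ℝ} (hf : Differentiable ℝ f) (hL : 0 ≤ L)
    (hLip : ∀ x z, ‖fderiv ℝ f x - fderiv ℝ f z‖ ≤ L * ‖x - z‖)
    (hJ : (-(fderiv ℝ f y)).IsPositive) (hρ : Δt * jacSpectralRadius f y ≤ β)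
    (hstable : ∀ j, 1 ≤ j → j < s → ‖mpStage C Δt f D y j‖ ≤ Cd * ‖y‖)
    (hD : ∀ j, 1 ≤ j → j < s → ‖D j - (f (y + mpStage C Δt f D y j) - f y)‖ ≤ r)
    (hsmall : L * Cd * ‖y‖ * Δt ≤ η) (hr : r ≤ η * ‖f y‖) {j : ℕ} (hj : j < s) :
    ‖mpStage C Δt f D y j‖ ≤ 2 * (Δt * ‖f y‖) := by
  induction j using Nat.strong_induction_on with
  | _ j ih =>
    have hbd {p : Polynomial ℝ} {M : ℝ} (hp : ∀ t, |t| ≤ C.ω₀ → |p.eval t| ≤ M) (hM : 0 ≤ M) :=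
      norm_aeval_shifted_jacobian_le hC.ω₁_pos hΔt hβ hJ hρ rfl hp hM
    -- Each stage perturbation has one share η ‖f y‖ from the Taylor remainder and one from the
    -- low-precision error. Then 2Kη ≤ 1 closes the induction with constant 1 + 1.
    have hM : 0 ≤ 2 * η * ‖f y‖ := by positivity
    have key := norm_add_stage_le hC hΔt.le (J := fderiv ℝ f y) rfl
      (fun k => hbd (fun t => abs_chebT_le k hC.one_le_ω₀) (chebT_pos k hC.one_le_ω₀).le)
      (fun k => hbd (fun t => abs_chebU_le k hC.one_le_ω₀) (chebU_pos k hC.one_le_ω₀).le)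
      (x := mpStage C Δt f D y) (v := 0) (h := f y)
      (e := fun i => D i - fderiv ℝ f y (mpStage C Δt f D y i)) rfl
      (by rw [map_zero, zero_add]; rfl)
      (fun i => by rw [map_zero, zero_add, add_sub_cancel]; rfl) hj.le hM (fun i hi hij => ?_)
    · rw [zero_add, norm_zero, zero_add] at key
      have h1 := mul_le_mul_of_nonneg_right (hC.b_mul_chebT'_le j hj.le)
        (mul_nonneg hΔt.le (norm_nonneg (f y)))
      have h2 := mul_le_mul_of_nonneg_right (hC.stageConst_le hj.le) (mul_nonneg hΔt.le hM)
      have h3 := mul_le_mul_of_nonneg_right hKη (mul_nonneg hΔt.le (norm_nonneg (f y)))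
      linarith
    · have his := hij.trans hj
      have h1 := hD i hi his
      have h2 := norm_sub_sub_fderiv_le hf hLip y (mpStage C Δt f D y i)
      have h3 := hstable i hi his
      have h4 := ih i hij his
      generalize mpStage C Δt f D y i = d at *
      have h3' := (norm_nonneg d).trans h3
      have h5 : L / 2 * ‖d‖ ^ 2 ≤ η * ‖f y‖ := by
        calc L / 2 * ‖d‖ ^ 2 = L / 2 * ‖d‖ * ‖d‖ := by ring
          _ ≤ L / 2 * (Cd * ‖y‖) * (2 * (Δt * ‖f y‖)) := by gcongr
          _ = L * Cd * ‖y‖ * Δt * ‖f y‖ := by ring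
          _ ≤ η * ‖f y‖ := by gcongr
      calc ‖D i - fderiv ℝ f y d‖
          = ‖(D i - (f (y + d) - f y)) + (f (y + d) - f y - fderiv ℝ f y d)‖ := by
            congr 1; abel
        _ ≤ _ := norm_add_le _ _
        _ ≤ 2 * η * ‖f y‖ := by linarith

/-! ### One-step error. -/

namespace OneStepAssumptions

variable {n : ℕ} {C : RKCCoeffs} {β : ℝ} {s : ℕ} {Δt : ℝ} {f : RKCState n → RKCState n}
  {D : ℕ → RKCState n} {y yh : RKCState n} {Cf Cd CΔ Ch ϵ : ℝ}

theorem Cf_nonneg (H : OneStepAssumptions C β s Δt f D y yh Cf Cd CΔ Ch ϵ) : 0 ≤ Cf :=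
  (norm_nonneg (fderiv ℝ (fderiv ℝ f) y)).trans (H.norm_second_deriv_le y)

theorem fderiv_lipschitz (H : OneStepAssumptions C β s Δt f D y yh Cf Cd CΔ Ch ϵ)
    (x z : RKCState n) : ‖fderiv ℝ f x - fderiv ℝ f z‖ ≤ Cf * ‖x - z‖ :=
  convex_univ.norm_image_sub_le_of_norm_fderiv_le
    (fun x _ => H.differentiable_fderiv x) (fun x _ => H.norm_second_deriv_le x)
    (Set.mem_univ z) (Set.mem_univ x)

theorem diff_le (H : OneStepAssumptions C β s Δt f D y yh Cf Cd CΔ Ch ϵ) {j : ℕ} (h1 : 1 ≤ j)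
    (h2 : j < s) : ‖D j - (f (yh + mpStage C Δt f D yh j) - f yh)‖ ≤
      min (Ch * ϵ * Δt) (CΔ * ‖yh‖) :=
  le_min (H.accurate_diff j h1 h2) (H.stable_diff j h1 h2)

/-- The one-step error in terms of bounds `Cd * m`, `Cd * mh` on the stage increments. -/
theorem norm_step_sub_step_le (H : OneStepAssumptions C β s Δt f D y yh Cf Cd CΔ Ch ϵ) {K : ℝ}
    (hC : C.Admissible s K) (hβ : 0 ≤ β → C.ω₁ * β ≤ 2 * C.ω₀) {m mh : ℝ}
    (hm : ∀ j, 1 ≤ j → j < s → ‖rkcStage C Δt f y j‖ ≤ Cd * m)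
    (hmh : ∀ j, 1 ≤ j → j < s → ‖mpStage C Δt f D yh j‖ ≤ Cd * mh) :
    ‖mpStep C s Δt f D yh - rkcStep C s Δt f y‖ ≤
      ‖yh - y‖ + Cf / 2 * ‖yh - y‖ ^ 2 * Δt
        + rkcStageConst C s * ((min (Ch * ϵ * Δt) (CΔ * ‖yh‖) + Cf / 2 * ‖yh - y‖ ^ 2
          + Cf * Cd ^ 2 * (mh ^ 2 + m ^ 2)) * Δt) := by
  have hΔt := H.step_pos
  have hCf := H.Cf_nonneg
  have hbd {p : Polynomial ℝ} {M : ℝ} (hp : ∀ t, |t| ≤ C.ω₀ → |p.eval t| ≤ M) (hM : 0 ≤ M) :=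
    norm_aeval_shifted_jacobian_le hC.ω₁_pos hΔt hβ (H.jac_nonpos y) H.stages_exact rfl hp hM
  have hr : 0 ≤ min (Ch * ϵ * Δt) (CΔ * ‖yh‖) :=
    le_min (mul_nonneg (mul_nonneg H.Ch_nonneg H.ϵ_pos.le) hΔt.le)
      (mul_nonneg H.CΔ_pos.le (norm_nonneg _))
  set v := yh - y with hv
  set J := fderiv ℝ f y
  set x : ℕ → RKCState n := fun j => mpStage C Δt f D yh j - rkcStage C Δt f y j with hx
  have hg : J v + (f yh - f y - J v) = f yh - f y := by abel
  have key := norm_add_stage_le hC hΔt.le (J := J) rfl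
    (fun k => hbd (fun t => abs_chebT_le k hC.one_le_ω₀) (chebT_pos k hC.one_le_ω₀).le)
    (fun k => hbd (fun t => abs_chebU_le k hC.one_le_ω₀) (chebU_pos k hC.one_le_ω₀).le)
    (x := x) (v := v) (h := f yh - f y - J v)
    (e := fun i => D i - (f (y + rkcStage C Δt f y i) - f y) - J (x i))
    (M := min (Ch * ϵ * Δt) (CΔ * ‖yh‖) + Cf / 2 * ‖v‖ ^ 2 + Cf * Cd ^ 2 * (mh ^ 2 + m ^ 2))
    (by simp [hx, mpStage, rkcStage])
    (by rw [hg]; simp [hx, mpStage, rkcStage, smul_sub])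
    (fun i => by
      rw [hg]
      simp only [hx, mpStage, rkcStage]
      module)
    le_rfl (by positivity) (fun i hi his => ?_)
  · have hstep : mpStep C s Δt f D yh - rkcStep C s Δt f y = v + x s := by
      simp only [mpStep, rkcStep, hx, hv]
      abel
    have hh := norm_sub_sub_fderiv_le H.differentiable H.fderiv_lipschitz y v
    rw [hv, add_sub_cancel, ← hv] at hh
    have h1 := mul_le_mul_of_nonneg_right (hC.b_mul_chebT'_le s le_rfl)
      (mul_nonneg hΔt.le (norm_nonneg (f yh - f y - J v)))
    have h2 := mul_le_mul_of_nonneg_left hh hΔt.le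
    rw [hstep]
    refine key.trans ?_
    linarith
  · have h1 := H.diff_le hi his
    have h2 := norm_sub_sub_fderiv_le H.differentiable H.fderiv_lipschitz yh
      (mpStage C Δt f D yh i)
    have h3 := norm_sub_sub_fderiv_le H.differentiable H.fderiv_lipschitz y (rkcStage C Δt f y i)
    have h4 := ((fderiv ℝ f yh - J).le_opNorm (mpStage C Δt f D yh i)).trans
      (mul_le_mul_of_nonneg_right (H.fderiv_lipschitz yh y) (norm_nonneg _))
    have h5 := hm i hi his
    have h6 := hmh i hi his
    simp only [hx]
    generalize mpStage C Δt f D yh i = dh at *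
    generalize rkcStage C Δt f y i = d at *
    have h7 : ‖d‖ ^ 2 ≤ Cd ^ 2 * m ^ 2 := by rw [← mul_pow]; gcongr
    have h8 : ‖dh‖ ^ 2 ≤ Cd ^ 2 * mh ^ 2 := by rw [← mul_pow]; gcongr
    -- Young's inequality splits the cost of replacing f'(ŷ) by f'(y) in the mixed-precision stage.
    have h9 : Cf * ‖v‖ * ‖dh‖ ≤ Cf / 2 * ‖v‖ ^ 2 + Cf / 2 * ‖dh‖ ^ 2 := by
      nlinarith [mul_nonneg hCf (sq_nonneg (‖v‖ - ‖dh‖))]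
    have h7' := mul_le_mul_of_nonneg_left h7 hCf
    have h8' := mul_le_mul_of_nonneg_left h8 hCf
    have h10 : 0 ≤ Cf * ‖d‖ ^ 2 := by positivity
    calc ‖D i - (f (y + d) - f y) - J (dh - d)‖
        = ‖(D i - (f (yh + dh) - f yh)) + (f (yh + dh) - f yh - fderiv ℝ f yh dh)
            + (fderiv ℝ f yh - J) dh - (f (y + d) - f y - J d)‖ := by
          rw [sub_apply, map_sub]
          congr 1
          abel
      _ ≤ _ := norm_sub_le _ _
      _ ≤ _ := add_le_add_left norm_add₃_le _
      _ ≤ _ := by linarith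

theorem exact_stage_le (H : OneStepAssumptions C β s Δt f D y yh Cf Cd CΔ Ch ϵ) {K η : ℝ}
    (hC : C.Admissible s K) (hβ : 0 ≤ β → C.ω₁ * β ≤ 2 * C.ω₀) (hη : 0 ≤ η) (hKη : 2 * K * η ≤ 1)
    (h : ExactFirstOrder η C s Δt f y Cf Cd) (j : ℕ) (h1 : 1 ≤ j) (hj : j < s) :
    ‖rkcStage C Δt f y j‖ ≤ Cd * min (Δt * ‖f y‖) ‖y‖ := by
  have hCd : 0 ≤ Cd := by linarith [H.two_le_Cd]
  rw [mul_min_of_nonneg _ _ hCd]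
  refine le_min ?_ (H.stable_exact j h1 hj.le)
  rcases h with h | h
  · exact h j h1 hj
  · have h2 : 2 * (Δt * ‖f y‖) ≤ Cd * (Δt * ‖f y‖) :=
      mul_le_mul_of_nonneg_right H.two_le_Cd (mul_nonneg H.step_pos.le (norm_nonneg _))
    refine le_trans ?_ h2
    rw [rkcStage_eq_mpStage]
    refine norm_mpStage_le_two_mul hC hβ hη hKη H.step_pos H.differentiable H.Cf_nonneg
      H.fderiv_lipschitz (H.jac_nonpos y) H.stages_exact (Cd := Cd) (r := 0) ?_ ?_ h
      (mul_nonneg hη (norm_nonneg _)) hj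
    · intro i hi his
      rw [← rkcStage_eq_mpStage]
      exact H.stable_exact i hi his.le
    · intro i hi his
      rw [← rkcStage_eq_mpStage, sub_self, norm_zero]

theorem mixed_stage_le (H : OneStepAssumptions C β s Δt f D y yh Cf Cd CΔ Ch ϵ) {K η : ℝ}
    (hC : C.Admissible s K) (hβ : 0 ≤ β → C.ω₁ * β ≤ 2 * C.ω₀) (hη : 0 ≤ η) (hKη : 2 * K * η ≤ 1)
    (h : MixedFirstOrder η C s Δt f D yh Cf Cd CΔ Ch ϵ) (j : ℕ) (h1 : 1 ≤ j) (hj : j < s) :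
    ‖mpStage C Δt f D yh j‖ ≤ Cd * min (Δt * ‖f yh‖) ‖yh‖ := by
  have hCd : 0 ≤ Cd := by linarith [H.two_le_Cd]
  rw [mul_min_of_nonneg _ _ hCd]
  refine le_min ?_ (H.stable_mixed j h1 hj.le)
  rcases h with h | ⟨h, hr⟩
  · exact h j h1 hj
  · exact (norm_mpStage_le_two_mul hC hβ hη hKη H.step_pos H.differentiable H.Cf_nonneg
      H.fderiv_lipschitz (H.jac_nonpos yh) H.stages_mixed
      (fun i hi his => H.stable_mixed i hi his.le) (fun i hi his => H.diff_le hi his) h hr hj).trans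
      (mul_le_mul_of_nonneg_right H.two_le_Cd (mul_nonneg H.step_pos.le (norm_nonneg _)))

end OneStepAssumptions

/-! ### Choice of constants and conclusion. -/

theorem mainTheorem2 :
    (∀ s : ℕ, 2 ≤ s →
      rkcStageConst (rkc2 s 0) s ≤ 4 * (s : ℝ) * ((s : ℝ) + 1) / ((s : ℝ) ^ 2 - 1) ∧
      rkcStageConst (rkc2 s 0) s ≤ 8) ∧
    ∀ ε : ℝ, 0 ≤ ε → ∃ K η : ℝ, 0 < η ∧
      (∀ s : ℕ, 2 ≤ s → rkcStageConst (rkc2 s ε) s ≤ K) ∧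
      ∀ (n s : ℕ) (Δt : ℝ) (f : RKCState n → RKCState n) (D : ℕ → RKCState n)
        (y yh : RKCState n) (Cf Cd CΔ Ch ϵ : ℝ),
        (1 ≤ s →
          OneStepAssumptions (rkc1 s ε) (rkcβ1 s ε) s Δt f D y yh Cf Cd CΔ Ch ϵ →
          (‖mpStep (rkc1 s ε) s Δt f D yh - rkcStep (rkc1 s ε) s Δt f y‖
              ≤ ‖yh - y‖ + Cf * ‖yh - y‖ ^ 2 * Δt + min (Ch * ϵ * Δt) (CΔ * ‖yh‖) * Δt
                + Cf * Cd ^ 2 * (‖yh‖ ^ 2 + ‖y‖ ^ 2) * Δt) ∧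
          (ExactFirstOrder η (rkc1 s ε) s Δt f y Cf Cd →
            MixedFirstOrder η (rkc1 s ε) s Δt f D yh Cf Cd CΔ Ch ϵ →
            ‖mpStep (rkc1 s ε) s Δt f D yh - rkcStep (rkc1 s ε) s Δt f y‖
              ≤ ‖yh - y‖ + Cf * ‖yh - y‖ ^ 2 * Δt + min (Ch * ϵ * Δt) (CΔ * ‖yh‖) * Δt
                + Cf * Cd ^ 2 * ((min (Δt * ‖f yh‖) ‖yh‖) ^ 2 + (min (Δt * ‖f y‖) ‖y‖) ^ 2) * Δt)) ∧
        (2 ≤ s →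
          OneStepAssumptions (rkc2 s ε) (rkcβ2 s ε) s Δt f D y yh Cf Cd CΔ Ch ϵ →
          (‖mpStep (rkc2 s ε) s Δt f D yh - rkcStep (rkc2 s ε) s Δt f y‖
              ≤ ‖yh - y‖ + Cf * (1 + 2 * rkcStageConst (rkc2 s ε) s) * ‖yh - y‖ ^ 2 * Δt
                + rkcStageConst (rkc2 s ε) s * min (Ch * ϵ * Δt) (CΔ * ‖yh‖) * Δt
                + rkcStageConst (rkc2 s ε) s * Cf * Cd ^ 2 * (‖yh‖ ^ 2 + ‖y‖ ^ 2) * Δt) ∧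
          (ExactFirstOrder η (rkc2 s ε) s Δt f y Cf Cd →
            MixedFirstOrder η (rkc2 s ε) s Δt f D yh Cf Cd CΔ Ch ϵ →
            ‖mpStep (rkc2 s ε) s Δt f D yh - rkcStep (rkc2 s ε) s Δt f y‖
              ≤ ‖yh - y‖ + Cf * (1 + 2 * rkcStageConst (rkc2 s ε) s) * ‖yh - y‖ ^ 2 * Δt
                + rkcStageConst (rkc2 s ε) s * min (Ch * ϵ * Δt) (CΔ * ‖yh‖) * Δt
                + rkcStageConst (rkc2 s ε) s * Cf * Cd ^ 2
                  * ((min (Δt * ‖f yh‖) ‖yh‖) ^ 2 + (min (Δt * ‖f y‖) ‖y‖) ^ 2) * Δt)) := by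
  have stage (ε : ℝ) (hε : 0 ≤ ε) {s : ℕ} (hs : 2 ≤ s) :
      rkcStageConst (rkc2 s ε) s ≤ 4 * (1 + ε / 4) ^ 2 :=
    (rkc2_admissible hs hε).stageConst_le le_rfl
  refine ⟨fun s hs => ?_, fun ε hε => ?_⟩
  · have h := stage 0 le_rfl hs
    norm_num at h
    have hs' : (2 : ℝ) ≤ s := by exact_mod_cast hs
    refine ⟨h.trans ?_, h.trans (by norm_num)⟩
    -- At ε = 0 the stage bound is C_s ≤ 4, already below 4s(s+1)/(s²-1) = 4s/(s-1).
    rw [le_div_iff₀ (by nlinarith)]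
    nlinarith
  · have hK : 1 ≤ (1 + ε / 4) ^ 2 := one_le_pow₀ (by linarith)
    have hη : (0 : ℝ) < 1 / (8 * (1 + ε / 4) ^ 2) := by positivity
    have hη2 : 2 * (4 * (1 + ε / 4) ^ 2) * (1 / (8 * (1 + ε / 4) ^ 2)) ≤ 1 := by
      apply le_of_eq
      field_simp
      norm_num
    -- K is the RKC2 admissibility constant and η = 1/(2K); this η also serves RKC1, whose constant
    -- is 1 ≤ K.
    refine ⟨4 * (1 + ε / 4) ^ 2, 1 / (8 * (1 + ε / 4) ^ 2), hη, fun s hs => stage ε hε hs,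
      fun n s Δt f D y yh Cf Cd CΔ Ch ϵ => ⟨fun hs H => ?_, fun hs H => ?_⟩⟩
    · have hC := rkc1_admissible hs hε
      have hβ := rkc1_ω₁_mul_β_le hs hε
      have hη1 : 2 * 1 * (1 / (8 * (1 + ε / 4) ^ 2)) ≤ (1 : ℝ) := by nlinarith
      have hCs := hC.stageConst_le le_rfl
      have hΔt := H.step_pos.le
      have hCf := H.Cf_nonneg
      have hr : 0 ≤ min (Ch * ϵ * Δt) (CΔ * ‖yh‖) :=
        le_min (mul_nonneg (mul_nonneg H.Ch_nonneg H.ϵ_pos.le) hΔt)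
          (mul_nonneg H.CΔ_pos.le (norm_nonneg _))
      have final {m mh : ℝ}
          (hm : ∀ j, 1 ≤ j → j < s → ‖rkcStage (rkc1 s ε) Δt f y j‖ ≤ Cd * m)
          (hmh : ∀ j, 1 ≤ j → j < s → ‖mpStage (rkc1 s ε) Δt f D yh j‖ ≤ Cd * mh) :
          ‖mpStep (rkc1 s ε) s Δt f D yh - rkcStep (rkc1 s ε) s Δt f y‖
              ≤ ‖yh - y‖ + Cf * ‖yh - y‖ ^ 2 * Δt + min (Ch * ϵ * Δt) (CΔ * ‖yh‖) * Δt
                + Cf * Cd ^ 2 * (mh ^ 2 + m ^ 2) * Δt := by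
        refine (H.norm_step_sub_step_le hC hβ hm hmh).trans ?_
        have := mul_le_mul_of_nonneg_right hCs (by positivity :
          0 ≤ (min (Ch * ϵ * Δt) (CΔ * ‖yh‖) + Cf / 2 * ‖yh - y‖ ^ 2
            + Cf * Cd ^ 2 * (mh ^ 2 + m ^ 2)) * Δt)
        linarith
      exact ⟨final (fun j h1 h2 => H.stable_exact j h1 h2.le)
          (fun j h1 h2 => H.stable_mixed j h1 h2.le),
        fun h1 h2 => final (H.exact_stage_le hC hβ hη.le hη1 h1)
          (H.mixed_stage_le hC hβ hη.le hη1 h2)⟩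
    · have hC := rkc2_admissible hs hε
      have hβ := rkc2_ω₁_mul_β_le hs hε
      have hCs := hC.stageConst_nonneg s
      have hΔt := H.step_pos.le
      have hCf := H.Cf_nonneg
      have final {m mh : ℝ}
          (hm : ∀ j, 1 ≤ j → j < s → ‖rkcStage (rkc2 s ε) Δt f y j‖ ≤ Cd * m)
          (hmh : ∀ j, 1 ≤ j → j < s → ‖mpStage (rkc2 s ε) Δt f D yh j‖ ≤ Cd * mh) :
          ‖mpStep (rkc2 s ε) s Δt f D yh - rkcStep (rkc2 s ε) s Δt f y‖
              ≤ ‖yh - y‖ + Cf * (1 + 2 * rkcStageConst (rkc2 s ε) s) * ‖yh - y‖ ^ 2 * Δt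
                + rkcStageConst (rkc2 s ε) s * min (Ch * ϵ * Δt) (CΔ * ‖yh‖) * Δt
                + rkcStageConst (rkc2 s ε) s * Cf * Cd ^ 2 * (mh ^ 2 + m ^ 2) * Δt := by
        refine (H.norm_step_sub_step_le hC hβ hm hmh).trans ?_
        have h1 : 0 ≤ Cf * ‖yh - y‖ ^ 2 * Δt := by positivity
        have h2 := mul_nonneg hCs h1
        linarith
      exact ⟨final (fun j h1 h2 => H.stable_exact j h1 h2.le)
          (fun j h1 h2 => H.stable_mixed j h1 h2.le),
        fun h1 h2 => final (H.exact_stage_le hC hβ hη.le hη2 h1)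
          (H.mixed_stage_le hC hβ hη.le hη2 h2)⟩
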